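/- Let $\mathbb{K}$ be a field and $q\in\mathbb{K}$. A quasi-poset $P=(V(P),\le_P)$ is a finite (possibly empty) set with a reflexive transitive relation; a simple oriented graph $G$ is a finite (possibly empty) set $V(G)$ of vertices with oriented edges between distinct vertices, at most one from $i$ to $j$ for each ordered pair $(i,j)$. Both are taken up to isomorphism. Let $H_{\mathcal{QP}}$, $H_{\mathcal{SG}}$ be the vector spaces with bases the quasi-posets and the simple oriented graphs. For an injection $\sigma:A\hookrightarrow V'$ with $A\subseteq V$, let $V\sqcup_\sigma V'=(V\sqcup V')/(a=\sigma(a),\ a\in A)$. For quasi-posets $P,Q$ and $\sigma:V(P)\supseteq A\hookrightarrow V(Q)$, $P\sqcup_\sigma Q$ is $V(P)\sqcup_\sigma V(Q)$ with the transitive closure of the union of the images of $\le_P$ and $\le_Q$. For simple oriented graphs $G,H$, $S(G\sqcup_\sigma H)$ is the simple oriented graph on $V(G)\sqcup_\sigma V(H)$ with an edge from $x$ to $y$ if $x\neq y$ and $G$ or $H$ has an edge from a representative of $x$ to a representative of $y$. An ideal is a set $A$ of elements with $i\in A$, $i\le_P j\Rightarrow j\in A$ (for graphs: $i\in A$ and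 an edge from $i$ to $j$ $\Rightarrow j\in A$); $I(\cdot)$ is the set of ideals and ${}_{|A}$ denotes restriction to $A$ (for graphs, the induced subgraph). **Theorem.** (1) $H_{\mathcal{QP}}$ is a Hopf algebra, with $$P\cdot_qQ=\sum_{\sigma:V(P)\supseteq A\hookrightarrow V(Q)}q^{|A|}\,P\sqcup_\sigma Q,\qquad \Delta(P)=\sum_{A\in I(P)}P_{|V(P)\setminus A}\otimes P_{|A},$$ whose unit is the empty quasi-poset and whose counit is $1$ on the empty quasi-poset and $0$ on the nonempty ones. Likewise $H_{\mathcal{SG}}$ is a Hopf algebra, with $$G\cdot_qH=\sum_{\sigma:V(G)\supseteq A\hookrightarrow V(H)}q^{|A|}\,S(G\sqcup_\sigma H),\qquad \Delta(G)=\sum_{A\in I(G)}G_{|V(G)\setminus A}\otimes G_{|A},$$ whose unit is the empty graph and whose counit is $1$ on the empty graph and $0$ on the nonempty ones. (2) The linear map $H_{\mathcal{SG}}\to H_{\mathcal{QP}}$ sending $G$ to $(V(G),\le_G)$, where $i\le_G j$ if there is a (possibly trivial) oriented path from $i$ to $j$ in $G$, is a morphism of Hopf algebras from $(H_{\mathcal{SG}},\cdot_q,\Delta)$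 to $(H_{\mathcal{QP}},\cdot_q,\Delta)$. (3) (Noncommutative version.) The same statements (1) and (2) hold, by the same formulas, for the vector spaces $\mathbf{H}_{\mathcal{QP}}$, $\mathbf{H}_{\mathcal{SG}}$ with bases the isomorphism classes of ordered quasi-posets and of ordered simple oriented graphs, i.e. those whose underlying set carries in addition a total order, unrelated to the quasi-order or to the edges and respected by isomorphisms. Here restrictions carry the restricted total order, $V(P)\sqcup V(Q)$ is totally ordered with $V(P)$ before $V(Q)$, $V(P)\sqcup_\sigma V(Q)$ is ordered by comparing the minimal representatives of classes (similarly for graphs), and $G\mapsto(V(G),\le_G)$ keeps the total order. -/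

import Mathlib

open scoped TensorProduct

universe u v

noncomputable section

/-! ## Gluing two finite sets along a partial injection -/

/-- A partial injection `V ⊇ A ↪ W`: a subset `A` of `V` with an injective map `A → W`. -/
abbrev PartialInj (V W : Type) : Type := Σ A : Set V, (A ↪ W)

instance PartialInj.instFinite (V W : Type) [Finite V] [Finite W] : Finite (PartialInj V W) :=
  inferInstanceAs (Finite (Σ A : Set V, (A ↪ W)))

instance PartialInj.instFintype (V W : Type) [Finite V] [Finite W] : Fintype (PartialInj V W) :=
  Fintype.ofFinite _

/-- The relation identifying `a ∈ A` with `σ a`. -/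
def PartialInj.Rel {V W : Type} (σ : PartialInj V W) (x y : V ⊕ W) : Prop :=
  x = y ∨ (∃ a : σ.1, x = Sum.inl a.1 ∧ y = Sum.inr (σ.2 a)) ∨
    (∃ a : σ.1, y = Sum.inl a.1 ∧ x = Sum.inr (σ.2 a))

theorem PartialInj.rel_equivalence {V W : Type} (σ : PartialInj V W) :
    Equivalence σ.Rel := by
  refine ⟨fun x => Or.inl rfl, ?_, ?_⟩
  · rintro x y (h | h | h)
    · exact Or.inl h.symm
    · exact Or.inr (Or.inr h)
    · exact Or.inr (Or.inl h)
  · rintro x y z (rfl | ⟨a, rfl, rfl⟩ | ⟨a, rfl, rfl⟩) h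
    · exact h
    · rcases h with rfl | ⟨b, h, _⟩ | ⟨b, rfl, h⟩
      · exact Or.inr (Or.inl ⟨a, rfl, rfl⟩)
      · simp at h
      · have : a = b := σ.2.injective (Sum.inr.inj h)
        exact Or.inl (by rw [this])
    · rcases h with rfl | ⟨b, h, rfl⟩ | ⟨b, _, h⟩
      · exact Or.inr (Or.inr ⟨a, rfl, rfl⟩)
      · have : a = b := Subtype.ext (Sum.inl.inj h)
        exact Or.inl (by rw [this])
      · simp at h

/-- The equivalence relation on the disjoint union generated by `a ∼ σ a`, `a ∈ A`. -/
def PartialInj.setoid {V W : Type} (σ : PartialInj V W) : Setoid (V ⊕ W) :=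
  ⟨σ.Rel, σ.rel_equivalence⟩

/-- The glued set `V ⊔_σ W`, quotient of the disjoint union by `a ∼ σ a`, `a ∈ A`. -/
def PartialInj.Glue {V W : Type} (σ : PartialInj V W) : Type := Quotient σ.setoid

/-- The canonical surjection `V ⊔ W → V ⊔_σ W`. -/
def PartialInj.mk {V W : Type} (σ : PartialInj V W) (x : V ⊕ W) : σ.Glue :=
  Quotient.mk σ.setoid x

theorem PartialInj.mk_surjective {V W : Type} (σ : PartialInj V W) :
    Function.Surjective σ.mk :=
  Quotient.exists_rep

instance PartialInj.instFintypeGlue {V W : Type} [Finite V] [Finite W] (σ : PartialInj V W) :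
    Fintype σ.Glue :=
  haveI : Finite σ.Glue := Finite.of_surjective σ.mk σ.mk_surjective
  Fintype.ofFinite _

/-- The union, on `V ⊔_σ W`, of (the images of) a relation on `V` and a relation on `W`. -/
def PartialInj.GlueRel {V W : Type} (σ : PartialInj V W) (r : V → V → Prop) (s : W → W → Prop)
    (x y : σ.Glue) : Prop :=
  (∃ i j : V, r i j ∧ x = σ.mk (Sum.inl i) ∧ y = σ.mk (Sum.inl j)) ∨
    (∃ i j : W, s i j ∧ x = σ.mk (Sum.inr i) ∧ y = σ.mk (Sum.inr j))

/-- The least representative of a class of `V ⊔_σ W` when `V`, `W` are totally ordered and all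
elements of `V` are put before all elements of `W` (`V ⊕ₗ W` is the ordinal sum). -/
def PartialInj.minRep {V W : Type} [Finite V] [Finite W] [LinearOrder V] [LinearOrder W]
    (σ : PartialInj V W) (x : σ.Glue) : V ⊕ₗ W :=
  haveI : Finite (V ⊕ₗ W) := inferInstanceAs (Finite (V ⊕ W))
  (Set.toFinite {a : V ⊕ₗ W | σ.mk (ofLex a) = x}).toFinset.min' <| by
    obtain ⟨a, ha⟩ := σ.mk_surjective x
    exact ⟨toLex a, (Set.Finite.mem_toFinset _).2 ha⟩

theorem PartialInj.mk_minRep {V W : Type} [Finite V] [Finite W] [LinearOrder V] [LinearOrder W]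
    (σ : PartialInj V W) (x : σ.Glue) : σ.mk (ofLex (σ.minRep x)) = x := by
  have : Finite (V ⊕ₗ W) := inferInstanceAs (Finite (V ⊕ W))
  have h : σ.minRep x ∈ (Set.toFinite {a : V ⊕ₗ W | σ.mk (ofLex a) = x}).toFinset :=
    Finset.min'_mem _ _
  have h' : σ.minRep x ∈ {a : V ⊕ₗ W | σ.mk (ofLex a) = x} := (Set.Finite.mem_toFinset _).1 h
  exact h'

theorem PartialInj.minRep_injective {V W : Type} [Finite V] [Finite W] [LinearOrder V]
    [LinearOrder W] (σ : PartialInj V W) : Function.Injective σ.minRep :=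
  fun x y h => by rw [← σ.mk_minRep x, ← σ.mk_minRep y, h]

/-- The total order on `V ⊔_σ W`: classes are compared through their least representatives. -/
abbrev PartialInj.glueOrder {V W : Type} [Finite V] [Finite W] [LinearOrder V] [LinearOrder W]
    (σ : PartialInj V W) : LinearOrder σ.Glue :=
  LinearOrder.lift' σ.minRep σ.minRep_injective

/-- Ideals of a relation `r` on `V`: subsets `A` with `i ∈ A` and `r i j` implying `j ∈ A`. -/
abbrev RelIdeal {V : Type} (r : V → V → Prop) : Type :=
  {A : Set V // ∀ i j : V, i ∈ A → r i j → j ∈ A}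

instance RelIdeal.instFintype {V : Type} [Finite V] (r : V → V → Prop) : Fintype (RelIdeal r) :=
  Fintype.ofFinite _

/-- The total order on a subset of a totally ordered set. -/
abbrev restrictOrder {V : Type} (o : LinearOrder V) (A : Set V) : LinearOrder A :=
  LinearOrder.lift' (fun i : A => (i : V)) Subtype.val_injective

/-! ## Simple oriented graphs -/

/-- A finite simple oriented graph (no loops, at most one edge from `i` to `j`). It may be empty,
and it may have both an edge from `i` to `j` and an edge from `j` to `i`. -/
structure SGraph where
  V : Type
  finite : Finite V
  Adj : V → V → Prop
  loopless : ∀ i, ¬ Adj i i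

attribute [instance] SGraph.finite

namespace SGraph

/-- Isomorphism of simple oriented graphs. -/
instance setoid : Setoid SGraph where
  r G H := Nonempty (G.Adj ≃r H.Adj)
  iseqv := ⟨fun _ => ⟨RelIso.refl _⟩, fun ⟨e⟩ => ⟨e.symm⟩, fun ⟨e⟩ ⟨f⟩ => ⟨e.trans f⟩⟩

/-- Isomorphism classes of simple oriented graphs. -/
def Class : Type 1 := Quotient setoid

/-- The isomorphism class of a simple oriented graph. -/
def cls (G : SGraph) : Class := Quotient.mk setoid G

/-- The empty graph. -/
def empty : SGraph := ⟨Empty, inferInstance, fun _ _ => False, fun _ h => h⟩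

/-- `S(G ⊔_σ H)`: glue along `σ`, delete loops, keep one edge of each multiple edge. -/
def glue (G H : SGraph) (σ : PartialInj G.V H.V) : SGraph where
  V := σ.Glue
  finite := inferInstance
  Adj x y := x ≠ y ∧ σ.GlueRel G.Adj H.Adj x y
  loopless _ h := h.1 rfl

/-- The induced subgraph on `A`. -/
def restrict (G : SGraph) (A : Set G.V) : SGraph where
  V := A
  finite := inferInstance
  Adj i j := G.Adj i j
  loopless i := G.loopless i

end SGraph

/-- An ordered simple oriented graph: its vertex set carries a total order (unrelated to edges). -/
structure OrdSGraph extends SGraph where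
  ord : LinearOrder V

namespace OrdSGraph

/-- Isomorphism: bijections preserving edges and the total orders. -/
instance setoid : Setoid OrdSGraph where
  r G H := ∃ e : G.V ≃ H.V, (∀ i j, G.Adj i j ↔ H.Adj (e i) (e j)) ∧
    ∀ i j, G.ord.le i j ↔ H.ord.le (e i) (e j)
  iseqv := by
    refine ⟨fun G => ⟨Equiv.refl _, fun _ _ => Iff.rfl, fun _ _ => Iff.rfl⟩, ?_, ?_⟩
    · rintro G H ⟨e, h, h'⟩
      exact ⟨e.symm, fun i j => by simp [h], fun i j => by simp [h']⟩
    · rintro G H L ⟨e, h, h'⟩ ⟨f, k, k'⟩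
      exact ⟨e.trans f, fun i j => (h i j).trans (k _ _), fun i j => (h' i j).trans (k' _ _)⟩

/-- Isomorphism classes of ordered simple oriented graphs. -/
def Class : Type 1 := Quotient setoid

/-- The isomorphism class of an ordered simple oriented graph. -/
def cls (G : OrdSGraph) : Class := Quotient.mk setoid G

/-- The empty graph. -/
def empty : OrdSGraph := ⟨SGraph.empty, inferInstanceAs (LinearOrder Empty)⟩

/-- `S(G ⊔_σ H)` with its total order. -/
def glue (G H : OrdSGraph) (σ : PartialInj G.V H.V) : OrdSGraph where
  toSGraph := G.toSGraph.glue H.toSGraph σ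
  ord := letI := G.ord; letI := H.ord; σ.glueOrder

/-- The induced ordered subgraph on `A`. -/
def restrict (G : OrdSGraph) (A : Set G.V) : OrdSGraph where
  toSGraph := G.toSGraph.restrict A
  ord := restrictOrder G.ord A

end OrdSGraph

/-! ## Quasi-posets -/

/-- A quasi-poset: a finite (possibly empty) set with a reflexive and transitive relation. -/
structure QuasiPoset where
  V : Type
  finite : Finite V
  le : V → V → Prop
  refl : ∀ i, le i i
  trans : ∀ i j k, le i j → le j k → le i k

attribute [instance] QuasiPoset.finite

namespace QuasiPoset

/-- Isomorphism of quasi-posets. -/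
instance setoid : Setoid QuasiPoset where
  r P Q := Nonempty (P.le ≃r Q.le)
  iseqv := ⟨fun _ => ⟨RelIso.refl _⟩, fun ⟨e⟩ => ⟨e.symm⟩, fun ⟨e⟩ ⟨f⟩ => ⟨e.trans f⟩⟩

/-- Isomorphism classes of quasi-posets. -/
def Class : Type 1 := Quotient setoid

/-- The isomorphism class of a quasi-poset. -/
def cls (P : QuasiPoset) : Class := Quotient.mk setoid P

/-- The empty quasi-poset. -/
def empty : QuasiPoset :=
  ⟨Empty, inferInstance, fun _ _ => True, fun _ => trivial, fun _ _ _ _ _ => trivial⟩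

/-- `P ⊔_σ Q`: the glued set with the transitive closure of the union of the two relations. -/
def glue (P Q : QuasiPoset) (σ : PartialInj P.V Q.V) : QuasiPoset where
  V := σ.Glue
  finite := inferInstance
  le := Relation.TransGen (σ.GlueRel P.le Q.le)
  refl x := by
    obtain ⟨i | i, rfl⟩ := σ.mk_surjective x
    · exact .single (Or.inl ⟨i, i, P.refl i, rfl, rfl⟩)
    · exact .single (Or.inr ⟨i, i, Q.refl i, rfl, rfl⟩)
  trans _ _ _ h h' := h.trans h'

/-- The restriction of a quasi-poset to a subset. -/
def restrict (P : QuasiPoset) (A : Set P.V) : QuasiPoset where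
  V := A
  finite := inferInstance
  le i j := P.le i j
  refl i := P.refl i
  trans i j k := P.trans i j k

end QuasiPoset

/-- An ordered quasi-poset: its underlying set carries moreover a total order, unrelated to the
quasi-order. -/
structure OrdQuasiPoset extends QuasiPoset where
  ord : LinearOrder V

namespace OrdQuasiPoset

/-- Isomorphism: bijections preserving the quasi-orders and the total orders. -/
instance setoid : Setoid OrdQuasiPoset where
  r P Q := ∃ e : P.V ≃ Q.V, (∀ i j, P.le i j ↔ Q.le (e i) (e j)) ∧
    ∀ i j, P.ord.le i j ↔ Q.ord.le (e i) (e j)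
  iseqv := by
    refine ⟨fun G => ⟨Equiv.refl _, fun _ _ => Iff.rfl, fun _ _ => Iff.rfl⟩, ?_, ?_⟩
    · rintro G H ⟨e, h, h'⟩
      exact ⟨e.symm, fun i j => by simp [h], fun i j => by simp [h']⟩
    · rintro G H L ⟨e, h, h'⟩ ⟨f, k, k'⟩
      exact ⟨e.trans f, fun i j => (h i j).trans (k _ _), fun i j => (h' i j).trans (k' _ _)⟩

/-- Isomorphism classes of ordered quasi-posets. -/
def Class : Type 1 := Quotient setoid

/-- The isomorphism class of an ordered quasi-poset. -/
def cls (P : OrdQuasiPoset) : Class := Quotient.mk setoid P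

/-- The empty quasi-poset. -/
def empty : OrdQuasiPoset := ⟨QuasiPoset.empty, inferInstanceAs (LinearOrder Empty)⟩

/-- `P ⊔_σ Q` with its total order. -/
def glue (P Q : OrdQuasiPoset) (σ : PartialInj P.V Q.V) : OrdQuasiPoset where
  toQuasiPoset := P.toQuasiPoset.glue Q.toQuasiPoset σ
  ord := letI := P.ord; letI := Q.ord; σ.glueOrder

/-- The restriction of an ordered quasi-poset to a subset. -/
def restrict (P : OrdQuasiPoset) (A : Set P.V) : OrdQuasiPoset where
  toQuasiPoset := P.toQuasiPoset.restrict A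
  ord := restrictOrder P.ord A

end OrdQuasiPoset

/-- The quasi-poset `p(G) = (V(G), ≤_G)`: `i ≤_G j` if there is a (possibly trivial) oriented path
from `i` to `j` in `G`. -/
def SGraph.toQP (G : SGraph) : QuasiPoset where
  V := G.V
  finite := G.finite
  le := Relation.ReflTransGen G.Adj
  refl _ := Relation.ReflTransGen.refl
  trans _ _ _ h h' := h.trans h'

/-- The ordered quasi-poset of an ordered simple graph; the total order is unchanged. -/
def OrdSGraph.toQP (G : OrdSGraph) : OrdQuasiPoset where
  toQuasiPoset := G.toSGraph.toQP
  ord := G.ord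

/-! ## The Hopf algebra structures

In each definition below, `H` is a Hopf algebra over `K`, whose underlying vector space is
generated by isomorphism classes through the basis `b`. -/

section


variable {K : Type u} [Field K] (q : K) {H : Type v} [Ring H] [HopfAlgebra K H]

/-- `H` is `(H_SG, ·_q, Δ)`. -/
structure IsHopfSG (b : Module.Basis SGraph.Class K H) : Prop where
  one : (1 : H) = b SGraph.empty.cls
  mul : ∀ P Q : SGraph, b P.cls * b Q.cls =
    ∑ σ : PartialInj P.V Q.V, q ^ σ.1.ncard • b (P.glue Q σ).cls
  counit_empty : Coalgebra.counit (R := K) (b SGraph.empty.cls) = 1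
  counit : ∀ P : SGraph, Nonempty P.V → Coalgebra.counit (R := K) (b P.cls) = 0
  comul : ∀ P : SGraph, Coalgebra.comul (R := K) (b P.cls) =
    ∑ A : RelIdeal P.Adj, b (P.restrict A.1ᶜ).cls ⊗ₜ[K] b (P.restrict A.1).cls

/-- `H` is `(H_QP, ·_q, Δ)`. -/
structure IsHopfQP (b : Module.Basis QuasiPoset.Class K H) : Prop where
  one : (1 : H) = b QuasiPoset.empty.cls
  mul : ∀ P Q : QuasiPoset, b P.cls * b Q.cls =
    ∑ σ : PartialInj P.V Q.V, q ^ σ.1.ncard • b (P.glue Q σ).cls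
  counit_empty : Coalgebra.counit (R := K) (b QuasiPoset.empty.cls) = 1
  counit : ∀ P : QuasiPoset, Nonempty P.V → Coalgebra.counit (R := K) (b P.cls) = 0
  comul : ∀ P : QuasiPoset, Coalgebra.comul (R := K) (b P.cls) =
    ∑ A : RelIdeal P.le, b (P.restrict A.1ᶜ).cls ⊗ₜ[K] b (P.restrict A.1).cls

/-- `H` is the ordered (noncommutative) analogue of `(H_SG, ·_q, Δ)`. -/
structure IsHopfOrdSG (b : Module.Basis OrdSGraph.Class K H) : Prop where
  one : (1 : H) = b OrdSGraph.empty.cls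
  mul : ∀ P Q : OrdSGraph, b P.cls * b Q.cls =
    ∑ σ : PartialInj P.V Q.V, q ^ σ.1.ncard • b (P.glue Q σ).cls
  counit_empty : Coalgebra.counit (R := K) (b OrdSGraph.empty.cls) = 1
  counit : ∀ P : OrdSGraph, Nonempty P.V → Coalgebra.counit (R := K) (b P.cls) = 0
  comul : ∀ P : OrdSGraph, Coalgebra.comul (R := K) (b P.cls) =
    ∑ A : RelIdeal P.Adj, b (P.restrict A.1ᶜ).cls ⊗ₜ[K] b (P.restrict A.1).cls

/-- `H` is the ordered (noncommutative) analogue of `(H_QP, ·_q, Δ)`. -/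
structure IsHopfOrdQP (b : Module.Basis OrdQuasiPoset.Class K H) : Prop where
  one : (1 : H) = b OrdQuasiPoset.empty.cls
  mul : ∀ P Q : OrdQuasiPoset, b P.cls * b Q.cls =
    ∑ σ : PartialInj P.V Q.V, q ^ σ.1.ncard • b (P.glue Q σ).cls
  counit_empty : Coalgebra.counit (R := K) (b OrdQuasiPoset.empty.cls) = 1
  counit : ∀ P : OrdQuasiPoset, Nonempty P.V → Coalgebra.counit (R := K) (b P.cls) = 0
  comul : ∀ P : OrdQuasiPoset, Coalgebra.comul (R := K) (b P.cls) =
    ∑ A : RelIdeal P.le, b (P.restrict A.1ᶜ).cls ⊗ₜ[K] b (P.restrict A.1).cls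

end

end

/-! ## Reindexing sums along a one-to-one correspondence -/

/-! A gluing of `V` and `W` is the same thing, up to a unique bijection of the target, as a pair of
injections `V → T ← W` that is jointly surjective: the partial injection is recovered from the pairs
with equal image (`PartialInj.exists_of_isJoint`, `PartialInj.ext_of_inl_eq_inr`). Each axiom
thereby becomes a matching of index sets. Both bracketings of a triple product run over jointly
surjective triples of injections (`PartialInj.sum_assoc`). A subset `S` of a gluing amounts to its
traces on the two pieces, a gluing of the traces and a gluing of their complements
(`PartialInj.sum_subset`), and `S` is an ideal exactly when both traces are; hence the coproduct is
multiplicative. The powers of `q` agree because the domain of a partial injection has `|V| + |W| -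
|T|` elements. Coassociativity compares two descriptions of chains of two ideals
(`RelObj.coassoc_vec`).

The delicate point is that transitive closure does not commute with restriction to an arbitrary
subset. It does for subsets closed upwards or downwards, since a path joining two of their points
stays inside, and the coproduct uses only these.

The four algebras are treated at once: an object carries one relation whose ideals are cut (graph or
quasi-order) and one that restricts to every subset (the trivial relation, or a total order for the
noncommutative version). The antipode exists because, in the coproduct, every term with a nonempty
ideal has a smaller left factor, so a convolution inverse of the identity can be built by recursion
on the number of vertices (`RelObj.exists_convLeftInv`).

Taking paths commutes with gluing and with the restrictions in use, and does not change the ideals,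
so it gives a bialgebra morphism; compatibility with antipodes follows from uniqueness of
convolution inverses. -/

theorem Fintype.sum_eq_sum_of_biUnique {ι κ M : Type*} [Fintype ι] [Fintype κ] [AddCommMonoid M]
    (R : ι → κ → Prop) (left_total : ∀ i, ∃ j, R i j) (right_total : ∀ j, ∃ i, R i j)
    (right_unique : ∀ i j j', R i j → R i j' → j = j')
    (left_unique : ∀ i i' j, R i j → R i' j → i = i')
    (F : ι → M) (G : κ → M) (h : ∀ i j, R i j → F i = G j) : ∑ i, F i = ∑ j, G j := by
  choose φ hφ using left_total
  refine Function.Bijective.sum_comp (e := φ) ⟨?_, ?_⟩ G |>.symm.trans ?_ |>.symm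
  · intro i i' hi
    exact left_unique i i' (φ i) (hφ i) (hi ▸ hφ i')
  · intro j
    obtain ⟨i, hi⟩ := right_total j
    exact ⟨i, right_unique _ _ _ (hφ i) hi⟩
  · exact Finset.sum_congr rfl fun i _ => (h _ _ (hφ i)).symm

/-! ## Partial injections as jointly surjective pairs of injections -/

/-- Two injections which are jointly surjective. -/
structure IsJoint {V W T : Type} (f : V → T) (g : W → T) : Prop where
  inj_left : Function.Injective f
  inj_right : Function.Injective g
  surj : ∀ t, (∃ v, f v = t) ∨ ∃ w, g w = t

theorem IsJoint.equiv_comp {V W T T' : Type} {f : V → T} {g : W → T} (h : IsJoint f g)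
    (e : T ≃ T') : IsJoint (fun v => e (f v)) (fun w => e (g w)) where
  inj_left := e.injective.comp h.inj_left
  inj_right := e.injective.comp h.inj_right
  surj t := by
    rcases h.surj (e.symm t) with ⟨v, hv⟩ | ⟨w, hw⟩
    · exact Or.inl ⟨v, by simp [hv]⟩
    · exact Or.inr ⟨w, by simp [hw]⟩

theorem IsJoint.comp_equiv {V W V' W' T : Type} {f : V → T} {g : W → T} (h : IsJoint f g)
    (a : V' ≃ V) (b : W' ≃ W) : IsJoint (fun v => f (a v)) (fun w => g (b w)) where
  inj_left := h.inj_left.comp a.injective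
  inj_right := h.inj_right.comp b.injective
  surj t := by
    rcases h.surj t with ⟨v, hv⟩ | ⟨w, hw⟩
    · exact Or.inl ⟨a.symm v, by simp [hv]⟩
    · exact Or.inr ⟨b.symm w, by simp [hw]⟩

/-- Maps out of jointly surjective pairs are determined by the kernel relation. -/
theorem IsJoint.exists_injective {V W T T' : Type} {f : V → T} {g : W → T} (h : IsJoint f g)
    {f' : V → T'} {g' : W → T'} (hf' : Function.Injective f') (hg' : Function.Injective g')
    (hk : ∀ v w, f v = g w ↔ f' v = g' w) :
    ∃ c : T → T', Function.Injective c ∧ (∀ v, c (f v) = f' v) ∧ ∀ w, c (g w) = g' w := by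
  -- The value at `t` is independent of the preimage: injectivity treats two preimages on the same
  -- side, `hk` one on each side.
  have key : ∀ t, ∃ t', (∀ v, f v = t → f' v = t') ∧ ∀ w, g w = t → g' w = t' := by
    intro t
    rcases h.surj t with ⟨v, rfl⟩ | ⟨w, rfl⟩
    · exact ⟨f' v, fun v' hv => by rw [h.inj_left hv], fun w hw => ((hk v w).1 hw.symm).symm⟩
    · exact ⟨g' w, fun v hv => (hk v w).1 hv, fun w' hw => by rw [h.inj_right hw]⟩
  choose c hc using key
  have hcf : ∀ v, c (f v) = f' v := fun v => ((hc (f v)).1 v rfl).symm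
  have hcg : ∀ w, c (g w) = g' w := fun w => ((hc (g w)).2 w rfl).symm
  refine ⟨c, ?_, hcf, hcg⟩
  intro x y hxy
  rcases h.surj x with ⟨v, rfl⟩ | ⟨w, rfl⟩ <;> rcases h.surj y with ⟨v', rfl⟩ | ⟨w', rfl⟩
  · rw [hcf, hcf] at hxy; rw [hf' hxy]
  · rw [hcf, hcg] at hxy; exact (hk _ _).2 hxy
  · rw [hcg, hcf] at hxy; exact ((hk _ _).2 hxy.symm).symm
  · rw [hcg, hcg] at hxy; rw [hg' hxy]

/-- Uniqueness half of the correspondence between gluings and jointly surjective pairs. -/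
theorem IsJoint.exists_equiv {V W T T' : Type} {f : V → T} {g : W → T} (h : IsJoint f g)
    {f' : V → T'} {g' : W → T'} (h' : IsJoint f' g') (hk : ∀ v w, f v = g w ↔ f' v = g' w) :
    ∃ e : T ≃ T', (∀ v, e (f v) = f' v) ∧ ∀ w, e (g w) = g' w := by
  obtain ⟨c, hc, hcf, hcg⟩ := h.exists_injective h'.inj_left h'.inj_right hk
  refine ⟨Equiv.ofBijective c ⟨hc, fun t => ?_⟩, hcf, hcg⟩
  rcases h'.surj t with ⟨v, rfl⟩ | ⟨w, rfl⟩
  · exact ⟨_, hcf v⟩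
  · exact ⟨_, hcg w⟩

namespace PartialInj

variable {V W X V' W' T : Type}

/-- The canonical map `V → V ⊔_σ W`. -/
def inl (σ : PartialInj V W) (v : V) : σ.Glue := σ.mk (Sum.inl v)

/-- The canonical map `W → V ⊔_σ W`. -/
def inr (σ : PartialInj V W) (w : W) : σ.Glue := σ.mk (Sum.inr w)

theorem mk_eq_mk (σ : PartialInj V W) {x y : V ⊕ W} : σ.mk x = σ.mk y ↔ σ.Rel x y :=
  Quotient.eq (r := σ.setoid)

/-- `PartialInj.Rel` is already transitive, so points of opposite sides are identified only when `σ`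
pairs them directly. -/
theorem inl_eq_inr (σ : PartialInj V W) {v : V} {w : W} :
    σ.inl v = σ.inr w ↔ ∃ h : v ∈ σ.1, σ.2 ⟨v, h⟩ = w := by
  rw [inl, inr, mk_eq_mk]
  constructor
  · rintro (h | ⟨⟨a, ha⟩, h1, h2⟩ | ⟨a, h1, h2⟩)
    · cases h
    · cases h1; cases h2; exact ⟨ha, rfl⟩
    · cases h1
  · rintro ⟨h, rfl⟩
    exact Or.inr (Or.inl ⟨⟨v, h⟩, rfl, rfl⟩)

theorem isJoint (σ : PartialInj V W) : IsJoint σ.inl σ.inr where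
  inj_left v v' h := by
    rcases σ.mk_eq_mk.1 h with h | ⟨a, _, h⟩ | ⟨a, _, h⟩
    · exact Sum.inl.inj h
    · cases h
    · cases h
  inj_right v v' h := by
    rcases σ.mk_eq_mk.1 h with h | ⟨a, h, _⟩ | ⟨a, h, _⟩
    · exact Sum.inr.inj h
    · cases h
    · cases h
  surj t := by
    obtain ⟨v | w, rfl⟩ := σ.mk_surjective t
    · exact Or.inl ⟨v, rfl⟩
    · exact Or.inr ⟨w, rfl⟩

/-- All uniqueness claims in the reindexings below reduce to this criterion, which avoids comparing
dependent pairs. -/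
theorem ext_of_inl_eq_inr {σ τ : PartialInj V W}
    (h : ∀ v w, σ.inl v = σ.inr w ↔ τ.inl v = τ.inr w) : σ = τ := by
  simp only [inl_eq_inr] at h
  obtain ⟨A, f⟩ := σ
  obtain ⟨B, g⟩ := τ
  have hAB : A = B := by
    ext v
    constructor
    · intro hv; exact ((h v _).1 ⟨hv, rfl⟩).1
    · intro hv; exact ((h v _).2 ⟨hv, rfl⟩).1
  subst hAB
  congr 1
  ext ⟨v, hv⟩
  obtain ⟨_, h'⟩ := (h v _).1 ⟨hv, rfl⟩
  exact h'.symm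

/-- Every jointly surjective pair of injections is a gluing. -/
theorem exists_of_isJoint {f : V → T} {g : W → T} (h : IsJoint f g) :
    ∃ (σ : PartialInj V W) (e : σ.Glue ≃ T), (∀ v, e (σ.inl v) = f v) ∧ ∀ w, e (σ.inr w) = g w := by
  -- The domain is the set of `v` whose image is also reached from `W`; the chosen preimage is
  -- forced since `g` is injective.
  let σ : PartialInj V W := ⟨{v | ∃ w, g w = f v}, fun v => v.2.choose, fun v v' hv => by
    have h1 := v.2.choose_spec
    have h2 := v'.2.choose_spec
    simp only at hv
    rw [hv] at h1
    exact Subtype.ext (h.inj_left (h1.symm.trans h2))⟩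
  refine ⟨σ, σ.isJoint.exists_equiv h fun v w => ?_⟩
  rw [inl_eq_inr]
  constructor
  · rintro ⟨hv, rfl⟩
    exact hv.choose_spec.symm
  · intro hvw
    refine ⟨⟨w, hvw.symm⟩, h.inj_right ?_⟩
    exact (Exists.choose_spec (⟨w, hvw.symm⟩ : ∃ w, g w = f v)).trans hvw

/-- Inclusion-exclusion for the two ranges, whose intersection is the image of the domain of `σ`. It
expresses the exponent of `q` through cardinalities, so that exponents can be compared by counting.
-/
theorem card_glue [Finite V] [Finite W] (σ : PartialInj V W) :
    Nat.card σ.Glue + σ.1.ncard = Nat.card V + Nat.card W := by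
  have hfin : Finite σ.Glue := inferInstance
  have h := Set.ncard_union_add_ncard_inter (Set.range σ.inl) (Set.range σ.inr)
  have hu : Set.range σ.inl ∪ Set.range σ.inr = Set.univ :=
    Set.eq_univ_of_forall fun t => σ.isJoint.surj t
  have hi : Set.range σ.inl ∩ Set.range σ.inr = σ.inl '' σ.1 := by
    ext t
    constructor
    · rintro ⟨⟨v, rfl⟩, ⟨w, hw⟩⟩
      exact ⟨v, (σ.inl_eq_inr.1 hw.symm).1, rfl⟩
    · rintro ⟨v, hv, rfl⟩
      exact ⟨⟨v, rfl⟩, ⟨σ.2 ⟨v, hv⟩, (σ.inl_eq_inr.2 ⟨hv, rfl⟩).symm⟩⟩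
  rw [hu, hi, Set.ncard_univ, Set.ncard_image_of_injective _ σ.isJoint.inj_left,
    ← Set.image_univ, ← Set.image_univ, Set.ncard_image_of_injective _ σ.isJoint.inj_left,
    Set.ncard_image_of_injective _ σ.isJoint.inj_right, Set.ncard_univ, Set.ncard_univ] at h
  exact h

/-- Transport of the indexing set of a sum over gluings along bijections. -/
theorem sum_congr {M : Type*} [AddCommMonoid M] [Finite V] [Finite W] [Finite V'] [Finite W']
    (a : V ≃ V') (b : W ≃ W') (F : PartialInj V W → M) (G : PartialInj V' W' → M)
    (h : ∀ (σ : PartialInj V W) (σ' : PartialInj V' W') (e : σ.Glue ≃ σ'.Glue),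
      (∀ v, e (σ.inl v) = σ'.inl (a v)) → (∀ w, e (σ.inr w) = σ'.inr (b w)) →
      σ.1.ncard = σ'.1.ncard → F σ = G σ') :
    ∑ σ, F σ = ∑ σ, G σ := by
  refine Fintype.sum_eq_sum_of_biUnique (fun σ σ' => ∃ e : σ.Glue ≃ σ'.Glue,
      (∀ v, e (σ.inl v) = σ'.inl (a v)) ∧ (∀ w, e (σ.inr w) = σ'.inr (b w))) ?_ ?_ ?_ ?_ _ _ ?_
  · intro σ
    obtain ⟨σ', e, h1, h2⟩ := exists_of_isJoint (σ.isJoint.comp_equiv a.symm b.symm)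
    refine ⟨σ', e.symm, fun v => ?_, fun w => ?_⟩
    · rw [Equiv.symm_apply_eq, h1, a.symm_apply_apply]
    · rw [Equiv.symm_apply_eq, h2, b.symm_apply_apply]
  · intro σ'
    obtain ⟨σ, e, h1, h2⟩ := exists_of_isJoint (σ'.isJoint.comp_equiv a b)
    exact ⟨σ, e, h1, h2⟩
  · rintro σ σ' σ'' ⟨e, h1, h2⟩ ⟨e', h1', h2'⟩
    refine ext_of_inl_eq_inr fun v w => ?_
    rw [← a.apply_symm_apply v, ← b.apply_symm_apply w, ← h1, ← h2, ← h1', ← h2',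
      e.injective.eq_iff, e'.injective.eq_iff]
  · rintro σ σ' σ'' ⟨e, h1, h2⟩ ⟨e', h1', h2'⟩
    refine ext_of_inl_eq_inr fun v w => ?_
    rw [← e.injective.eq_iff, h1, h2, ← e'.injective.eq_iff, h1', h2']
  · rintro σ σ' ⟨e, h1, h2⟩
    refine h σ σ' e h1 h2 ?_
    have c1 := σ.card_glue
    have c2 := σ'.card_glue
    rw [Nat.card_congr e, Nat.card_congr a, Nat.card_congr b] at c1
    omega

/-- Transport of the indexing set of a sum over double gluings along associativity. -/
theorem sum_assoc {M : Type*} [AddCommMonoid M] [Finite V] [Finite W] [Finite X]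
    (F : (σ : PartialInj V W) → PartialInj σ.Glue X → M)
    (G : (σ : PartialInj W X) → PartialInj V σ.Glue → M)
    (h : ∀ (σ : PartialInj V W) (τ : PartialInj σ.Glue X) (σ' : PartialInj W X)
      (τ' : PartialInj V σ'.Glue) (e : τ.Glue ≃ τ'.Glue),
      (∀ v, e (τ.inl (σ.inl v)) = τ'.inl v) → (∀ w, e (τ.inl (σ.inr w)) = τ'.inr (σ'.inl w)) →
      (∀ x, e (τ.inr x) = τ'.inr (σ'.inr x)) →
      σ.1.ncard + τ.1.ncard = σ'.1.ncard + τ'.1.ncard → F σ τ = G σ' τ') :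
    ∑ σ, ∑ τ, F σ τ = ∑ σ, ∑ τ, G σ τ := by
  rw [← Fintype.sum_sigma', ← Fintype.sum_sigma']
  -- Two bracketings correspond when they induce the same triple of maps from `V`, `W`, `X` up to a
  -- bijection of the total sets.
  refine Fintype.sum_eq_sum_of_biUnique (fun p p' => ∃ e : p.2.Glue ≃ p'.2.Glue,
      (∀ v, e (p.2.inl (p.1.inl v)) = p'.2.inl v) ∧
      (∀ w, e (p.2.inl (p.1.inr w)) = p'.2.inr (p'.1.inl w)) ∧
      (∀ x, e (p.2.inr x) = p'.2.inr (p'.1.inr x))) ?_ ?_ ?_ ?_ _ _ ?_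
  · rintro ⟨σ, τ⟩
    -- The gluing of `W` and `X` is found inside the total set, as the part that they cover.
    let S : Set τ.Glue := {t | (∃ w, τ.inl (σ.inr w) = t) ∨ ∃ x, τ.inr x = t}
    have hS : IsJoint (fun w => (⟨τ.inl (σ.inr w), Or.inl ⟨w, rfl⟩⟩ : S))
        (fun x => (⟨τ.inr x, Or.inr ⟨x, rfl⟩⟩ : S)) :=
      { inj_left := fun w w' h =>
          σ.isJoint.inj_right (τ.isJoint.inj_left (congrArg Subtype.val h))
        inj_right := fun x x' h => τ.isJoint.inj_right (congrArg Subtype.val h)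
        surj := by
          rintro ⟨t, ⟨w, rfl⟩ | ⟨x, rfl⟩⟩
          · exact Or.inl ⟨w, rfl⟩
          · exact Or.inr ⟨x, rfl⟩ }
    obtain ⟨σ', e, h1, h2⟩ := exists_of_isJoint hS
    have hT : IsJoint (fun v => τ.inl (σ.inl v)) (fun y => (e y : τ.Glue)) :=
      { inj_left := τ.isJoint.inj_left.comp σ.isJoint.inj_left
        inj_right := Subtype.val_injective.comp e.injective
        surj := by
          intro t
          rcases τ.isJoint.surj t with ⟨t, rfl⟩ | ⟨x, rfl⟩
          · rcases σ.isJoint.surj t with ⟨v, rfl⟩ | ⟨w, rfl⟩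
            · exact Or.inl ⟨v, rfl⟩
            · exact Or.inr ⟨σ'.inl w, by simp [h1]⟩
          · exact Or.inr ⟨σ'.inr x, by simp [h2]⟩ }
    obtain ⟨τ', e', h1', h2'⟩ := exists_of_isJoint hT
    refine ⟨⟨σ', τ'⟩, e'.symm, fun v => ?_, fun w => ?_, fun x => ?_⟩
    · simp only [Equiv.symm_apply_eq, h1']
    · simp only [Equiv.symm_apply_eq, h2', h1]
    · simp only [Equiv.symm_apply_eq, h2', h2]
  · rintro ⟨σ, τ⟩
    let S : Set τ.Glue := {t | (∃ v, τ.inl v = t) ∨ ∃ w, τ.inr (σ.inl w) = t}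
    have hS : IsJoint (fun v => (⟨τ.inl v, Or.inl ⟨v, rfl⟩⟩ : S))
        (fun w => (⟨τ.inr (σ.inl w), Or.inr ⟨w, rfl⟩⟩ : S)) :=
      { inj_left := fun x x' h => τ.isJoint.inj_left (congrArg Subtype.val h)
        inj_right := fun w w' h =>
          σ.isJoint.inj_left (τ.isJoint.inj_right (congrArg Subtype.val h))
        surj := by
          rintro ⟨t, ⟨w, rfl⟩ | ⟨x, rfl⟩⟩
          · exact Or.inl ⟨w, rfl⟩
          · exact Or.inr ⟨x, rfl⟩ }
    obtain ⟨σ', e, h1, h2⟩ := exists_of_isJoint hS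
    have hT : IsJoint (fun y => (e y : τ.Glue)) (fun x => τ.inr (σ.inr x)) :=
      { inj_right := τ.isJoint.inj_right.comp σ.isJoint.inj_right
        inj_left := Subtype.val_injective.comp e.injective
        surj := by
          intro t
          rcases τ.isJoint.surj t with ⟨x, rfl⟩ | ⟨t, rfl⟩
          · exact Or.inl ⟨σ'.inl x, by simp [h1]⟩
          · rcases σ.isJoint.surj t with ⟨v, rfl⟩ | ⟨w, rfl⟩
            · exact Or.inl ⟨σ'.inr v, by simp [h2]⟩
            · exact Or.inr ⟨w, rfl⟩ }
    obtain ⟨τ', e', h1', h2'⟩ := exists_of_isJoint hT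
    refine ⟨⟨σ', τ'⟩, e', fun v => ?_, fun w => ?_, fun x => ?_⟩
    · simp only [h1', h1]
    · simp only [h1', h2]
    · simp only [h2']
  · rintro ⟨σ, τ⟩ ⟨σ', τ'⟩ ⟨σ'', τ''⟩ ⟨e, h1, h2, h3⟩ ⟨e', h1', h2', h3'⟩
    dsimp only at e e' h1 h2 h3 h1' h2' h3'
    -- The inner identifications can be read off in the total set, because the inner gluing injects
    -- into it.
    obtain rfl : σ' = σ'' := by
      refine ext_of_inl_eq_inr fun w x => ?_
      rw [← τ'.isJoint.inj_right.eq_iff, ← h2, ← h3, ← τ''.isJoint.inj_right.eq_iff, ← h2', ← h3',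
        e.injective.eq_iff, e'.injective.eq_iff]
    obtain rfl : τ' = τ'' := by
      refine ext_of_inl_eq_inr fun v y => ?_
      rcases σ'.isJoint.surj y with ⟨w, rfl⟩ | ⟨x, rfl⟩
      · rw [← h1, ← h2, ← h1', ← h2', e.injective.eq_iff, e'.injective.eq_iff]
      · rw [← h1, ← h3, ← h1', ← h3', e.injective.eq_iff, e'.injective.eq_iff]
    rfl
  · rintro ⟨σ', τ'⟩ ⟨σ'', τ''⟩ ⟨σ, τ⟩ ⟨e, h1, h2, h3⟩ ⟨e', h1', h2', h3'⟩
    dsimp only at e e' h1 h2 h3 h1' h2' h3'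
    obtain rfl : σ' = σ'' := by
      refine ext_of_inl_eq_inr fun w x => ?_
      rw [← τ'.isJoint.inj_left.eq_iff, ← e.injective.eq_iff, h1, h2, ← h1', ← h2',
        e'.injective.eq_iff, τ''.isJoint.inj_left.eq_iff]
    obtain rfl : τ' = τ'' := by
      refine ext_of_inl_eq_inr fun y x => ?_
      rw [← e.injective.eq_iff, ← e'.injective.eq_iff, h3, h3']
      rcases σ'.isJoint.surj y with ⟨v, rfl⟩ | ⟨w, rfl⟩
      · rw [h1, h1']
      · rw [h2, h2']
    rfl
  · rintro ⟨σ, τ⟩ ⟨σ', τ'⟩ ⟨e, h1, h2, h3⟩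
    refine h σ τ σ' τ' e h1 h2 h3 ?_
    -- Both exponents equal `|V| + |W| + |X|` minus the cardinality of the total set.
    have c1 := σ.card_glue
    have c2 := τ.card_glue
    have c3 := σ'.card_glue
    have c4 := τ'.card_glue
    have c5 : Nat.card τ.Glue = Nat.card τ'.Glue := Nat.card_congr e
    omega

end PartialInj

/-! ### Subsets of a gluing and their traces on the pieces -/

namespace PartialInj

variable {V W : Type}

/-- A pair of a gluing and of a subset of the glued set amounts to two subsets `A`, `B` of the
pieces together with a gluing of `A`, `B` and a gluing of their complements. Here `C`, `D`, `E`
encode which subsets are considered. -/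
theorem sum_subset {M : Type*} [AddCommMonoid M] [Finite V] [Finite W]
    (C : Set V → Prop) (D : Set W → Prop) (E : (σ : PartialInj V W) → Set σ.Glue → Prop)
    (hE : ∀ (σ : PartialInj V W) (S : Set σ.Glue), E σ S ↔ C (σ.inl ⁻¹' S) ∧ D (σ.inr ⁻¹' S))
    [Fintype {A // C A}] [Fintype {B // D B}] [∀ σ, Fintype {S // E σ S}]
    (F : (σ : PartialInj V W) → {S // E σ S} → M)
    (G : (A : {A // C A}) → (B : {B // D B}) → PartialInj ↥(A.1ᶜ) ↥(B.1ᶜ) →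
      PartialInj ↥A.1 ↥B.1 → M)
    (h : ∀ (σ : PartialInj V W) (S : {S // E σ S}) (A : {A // C A}) (B : {B // D B})
      (σ' : PartialInj ↥(A.1ᶜ) ↥(B.1ᶜ)) (σ'' : PartialInj ↥A.1 ↥B.1)
      (e' : σ'.Glue ≃ ↥(S.1ᶜ)) (e'' : σ''.Glue ≃ ↥S.1),
      A.1 = σ.inl ⁻¹' S.1 → B.1 = σ.inr ⁻¹' S.1 →
      (∀ v, (e' (σ'.inl v) : σ.Glue) = σ.inl v) → (∀ w, (e' (σ'.inr w) : σ.Glue) = σ.inr w) →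
      (∀ v, (e'' (σ''.inl v) : σ.Glue) = σ.inl v) → (∀ w, (e'' (σ''.inr w) : σ.Glue) = σ.inr w) →
      σ.1.ncard = σ'.1.ncard + σ''.1.ncard → F σ S = G A B σ' σ'') :
    ∑ σ, ∑ S, F σ S = ∑ A, ∑ B, ∑ σ', ∑ σ'', G A B σ' σ'' := by
  have hpre : ∀ (σ : PartialInj V W) (S : Set σ.Glue),
      IsJoint (fun v : ↥(σ.inl ⁻¹' S) => (⟨σ.inl v, v.2⟩ : S))
        (fun w : ↥(σ.inr ⁻¹' S) => (⟨σ.inr w, w.2⟩ : S)) := fun σ S =>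
    { inj_left := fun v v' hv => Subtype.ext (σ.isJoint.inj_left (congrArg Subtype.val hv))
      inj_right := fun v v' hv => Subtype.ext (σ.isJoint.inj_right (congrArg Subtype.val hv))
      surj := by
        rintro ⟨t, ht⟩
        rcases σ.isJoint.surj t with ⟨v, rfl⟩ | ⟨w, rfl⟩
        · exact Or.inl ⟨⟨v, ht⟩, rfl⟩
        · exact Or.inr ⟨⟨w, ht⟩, rfl⟩ }
  have hl : ∑ σ, ∑ S, F σ S = ∑ p : Σ σ, {S // E σ S}, F p.1 p.2 := by
    rw [Fintype.sum_sigma]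
  have hr : ∑ A, ∑ B, ∑ σ', ∑ σ'', G A B σ' σ'' =
      ∑ p : Σ A : {A // C A}, Σ B : {B // D B}, Σ _ : PartialInj ↥(A.1ᶜ) ↥(B.1ᶜ),
        PartialInj ↥A.1 ↥B.1, G p.1 p.2.1 p.2.2.1 p.2.2.2 := by
    simp only [Fintype.sum_sigma]
  rw [hl, hr]
  refine Fintype.sum_eq_sum_of_biUnique (fun (p : Σ σ, {S // E σ S})
      (p' : Σ A : {A // C A}, Σ B : {B // D B}, Σ _ : PartialInj ↥(A.1ᶜ) ↥(B.1ᶜ),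
        PartialInj ↥A.1 ↥B.1) =>
      p'.1.1 = p.1.inl ⁻¹' p.2.1 ∧ p'.2.1.1 = p.1.inr ⁻¹' p.2.1 ∧
      ∃ (e' : p'.2.2.1.Glue ≃ ↥(p.2.1ᶜ)) (e'' : p'.2.2.2.Glue ≃ ↥p.2.1),
      (∀ v, (e' (p'.2.2.1.inl v) : p.1.Glue) = p.1.inl v) ∧
      (∀ w, (e' (p'.2.2.1.inr w) : p.1.Glue) = p.1.inr w) ∧
      (∀ v, (e'' (p'.2.2.2.inl v) : p.1.Glue) = p.1.inl v) ∧
      (∀ w, (e'' (p'.2.2.2.inr w) : p.1.Glue) = p.1.inr w)) ?_ ?_ ?_ ?_ _ _ ?_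
  · rintro ⟨σ, S, hS⟩
    obtain ⟨σ', e', h1', h2'⟩ := exists_of_isJoint (hpre σ Sᶜ)
    obtain ⟨σ'', e'', h1'', h2''⟩ := exists_of_isJoint (hpre σ S)
    refine ⟨⟨⟨_, ((hE _ _).1 hS).1⟩, ⟨_, ((hE _ _).1 hS).2⟩, σ', σ''⟩, rfl, rfl, e', e'', ?_⟩
    exact ⟨fun v => congrArg Subtype.val (h1' v), fun v => congrArg Subtype.val (h2' v),
      fun v => congrArg Subtype.val (h1'' v), fun v => congrArg Subtype.val (h2'' v)⟩
  · rintro ⟨⟨A, hA⟩, ⟨B, hB⟩, σ', σ''⟩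
    dsimp only at σ' σ''
    classical
    -- Inverse construction: `V` and `W` are mapped to the disjoint union of the two small gluings,
    -- with `A` and `B` going to the right summand, which then plays the role of `S`.
    let f : V → σ'.Glue ⊕ σ''.Glue := fun v =>
      if hv : v ∈ A then Sum.inr (σ''.inl ⟨v, hv⟩) else Sum.inl (σ'.inl ⟨v, hv⟩)
    let g : W → σ'.Glue ⊕ σ''.Glue := fun w =>
      if hw : w ∈ B then Sum.inr (σ''.inr ⟨w, hw⟩) else Sum.inl (σ'.inr ⟨w, hw⟩)
    have f1 : ∀ v (hv : v ∈ A), f v = Sum.inr (σ''.inl ⟨v, hv⟩) := fun v hv => dif_pos hv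
    have f2 : ∀ v (hv : v ∉ A), f v = Sum.inl (σ'.inl ⟨v, hv⟩) := fun v hv => dif_neg hv
    have g1 : ∀ v (hv : v ∈ B), g v = Sum.inr (σ''.inr ⟨v, hv⟩) := fun v hv => dif_pos hv
    have g2 : ∀ v (hv : v ∉ B), g v = Sum.inl (σ'.inr ⟨v, hv⟩) := fun v hv => dif_neg hv
    have hfg : IsJoint f g :=
      { inj_left := by
          intro v v' hv
          by_cases h1 : v ∈ A <;> by_cases h2 : v' ∈ A
          · rw [f1 _ h1, f1 _ h2] at hv
            exact congrArg Subtype.val (σ''.isJoint.inj_left (Sum.inr.inj hv))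
          · rw [f1 _ h1, f2 _ h2] at hv; cases hv
          · rw [f2 _ h1, f1 _ h2] at hv; cases hv
          · rw [f2 _ h1, f2 _ h2] at hv
            exact congrArg Subtype.val (σ'.isJoint.inj_left (Sum.inl.inj hv))
        inj_right := by
          intro v v' hv
          by_cases h1 : v ∈ B <;> by_cases h2 : v' ∈ B
          · rw [g1 _ h1, g1 _ h2] at hv
            exact congrArg Subtype.val (σ''.isJoint.inj_right (Sum.inr.inj hv))
          · rw [g1 _ h1, g2 _ h2] at hv; cases hv
          · rw [g2 _ h1, g1 _ h2] at hv; cases hv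
          · rw [g2 _ h1, g2 _ h2] at hv
            exact congrArg Subtype.val (σ'.isJoint.inj_right (Sum.inl.inj hv))
        surj := by
          rintro (t | t)
          · rcases σ'.isJoint.surj t with ⟨⟨v, hv⟩, rfl⟩ | ⟨⟨v, hv⟩, rfl⟩
            · exact Or.inl ⟨v, f2 v hv⟩
            · exact Or.inr ⟨v, g2 v hv⟩
          · rcases σ''.isJoint.surj t with ⟨⟨v, hv⟩, rfl⟩ | ⟨⟨v, hv⟩, rfl⟩
            · exact Or.inl ⟨v, f1 v hv⟩
            · exact Or.inr ⟨v, g1 v hv⟩ }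
    obtain ⟨σ, e, h1, h2⟩ := exists_of_isJoint hfg
    let S : Set σ.Glue := {t | (e t).isRight}
    have hAS : A = σ.inl ⁻¹' S := by
      ext v
      by_cases hv : v ∈ A
      · simp [S, h1, f1 v hv, hv]
      · simp [S, h1, f2 v hv, hv]
    have hBS : B = σ.inr ⁻¹' S := by
      ext v
      by_cases hv : v ∈ B
      · simp [S, h2, g1 v hv, hv]
      · simp [S, h2, g2 v hv, hv]
    have hS : E σ S := (hE _ _).2 ⟨hAS ▸ hA, hBS ▸ hB⟩
    let e' : σ'.Glue ≃ ↥(Sᶜ) := Equiv.ofBijective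
      (fun t => ⟨e.symm (Sum.inl t), by simp [S]⟩) ⟨fun t t' htt => by
        simpa using htt, by
        rintro ⟨t, ht⟩
        obtain ⟨s | s, rfl⟩ := e.symm.surjective t
        · exact ⟨s, rfl⟩
        · simp [S] at ht⟩
    let e'' : σ''.Glue ≃ ↥S := Equiv.ofBijective
      (fun t => ⟨e.symm (Sum.inr t), by simp [S]⟩) ⟨fun t t' htt => by
        simpa using htt, by
        rintro ⟨t, ht⟩
        obtain ⟨s | s, rfl⟩ := e.symm.surjective t
        · simp [S] at ht
        · exact ⟨s, rfl⟩⟩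
    refine ⟨⟨σ, S, hS⟩, hAS, hBS, e', e'', ?_, ?_, ?_, ?_⟩
    · rintro ⟨v, hv⟩
      exact (Equiv.symm_apply_eq _).2 (by rw [h1, f2 v hv])
    · rintro ⟨v, hv⟩
      exact (Equiv.symm_apply_eq _).2 (by rw [h2, g2 v hv])
    · rintro ⟨v, hv⟩
      exact (Equiv.symm_apply_eq _).2 (by rw [h1, f1 v hv])
    · rintro ⟨v, hv⟩
      exact (Equiv.symm_apply_eq _).2 (by rw [h2, g1 v hv])
  · rintro ⟨σ, S, hS⟩ ⟨⟨A, hA⟩, ⟨B, hB⟩, σ', σ''⟩ ⟨⟨A', hA'⟩, ⟨B', hB'⟩, τ', τ''⟩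
      ⟨h1, h2, e', e'', k1, k2, k3, k4⟩ ⟨h1', h2', f', f'', l1, l2, l3, l4⟩
    dsimp only at *
    obtain rfl : A = A' := h1.trans h1'.symm
    obtain rfl : B = B' := h2.trans h2'.symm
    obtain rfl : σ' = τ' := ext_of_inl_eq_inr fun v w => by
      rw [← e'.injective.eq_iff, ← f'.injective.eq_iff, Subtype.ext_iff, Subtype.ext_iff,
        k1, k2, l1, l2]
    obtain rfl : σ'' = τ'' := ext_of_inl_eq_inr fun v w => by
      rw [← e''.injective.eq_iff, ← f''.injective.eq_iff, Subtype.ext_iff, Subtype.ext_iff,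
        k3, k4, l3, l4]
    rfl
  · rintro ⟨σ, S, hS⟩ ⟨τ, S', hS'⟩ ⟨⟨A, hA⟩, ⟨B, hB⟩, σ', σ''⟩
      ⟨h1, h2, e', e'', k1, k2, k3, k4⟩ ⟨h1', h2', f', f'', l1, l2, l3, l4⟩
    dsimp only at *
    -- Identified points lie both in `S` or both outside it, so the two small gluings determine
    -- which points `σ` identifies.
    have key : ∀ (σ : PartialInj V W) (S : Set σ.Glue) (h1 : A = σ.inl ⁻¹' S)
        (h2 : B = σ.inr ⁻¹' S) (e' : σ'.Glue ≃ ↥(Sᶜ)) (e'' : σ''.Glue ≃ ↥S)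
        (k1 : ∀ v, (e' (σ'.inl v) : σ.Glue) = σ.inl v)
        (k2 : ∀ v, (e' (σ'.inr v) : σ.Glue) = σ.inr v)
        (k3 : ∀ v, (e'' (σ''.inl v) : σ.Glue) = σ.inl v)
        (k4 : ∀ v, (e'' (σ''.inr v) : σ.Glue) = σ.inr v) v w, σ.inl v = σ.inr w ↔
        (∃ (hv : v ∈ A) (hw : w ∈ B), σ''.inl ⟨v, hv⟩ = σ''.inr ⟨w, hw⟩) ∨
        ∃ (hv : v ∈ Aᶜ) (hw : w ∈ Bᶜ), σ'.inl ⟨v, hv⟩ = σ'.inr ⟨w, hw⟩ := by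
      intro σ S h1 h2 e' e'' k1 k2 k3 k4 v w
      constructor
      · intro hvw
        by_cases hv : σ.inl v ∈ S
        · have hvA : v ∈ A := h1 ▸ hv
          have hwB : w ∈ B := by rw [h2]; exact (hvw ▸ hv :)
          refine Or.inl ⟨hvA, hwB, e''.injective (Subtype.ext ?_)⟩
          rw [k3, k4]
          exact hvw
        · have hvA : v ∈ Aᶜ := by rw [h1]; exact hv
          have hwB : w ∈ Bᶜ := by rw [h2]; exact (hvw ▸ hv :)
          refine Or.inr ⟨hvA, hwB, e'.injective (Subtype.ext ?_)⟩
          rw [k1, k2]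
          exact hvw
      · rintro (⟨hv, hw, he⟩ | ⟨hv, hw, he⟩)
        · have := congrArg Subtype.val (congrArg e'' he)
          rwa [k3, k4] at this
        · have := congrArg Subtype.val (congrArg e' he)
          rwa [k1, k2] at this
    obtain rfl : σ = τ := ext_of_inl_eq_inr fun v w =>
      (key σ S h1 h2 e' e'' k1 k2 k3 k4 v w).trans (key τ S' h1' h2' f' f'' l1 l2 l3 l4 v w).symm
    obtain rfl : S = S' := by
      ext t
      rcases σ.isJoint.surj t with ⟨v, rfl⟩ | ⟨v, rfl⟩
      · exact Set.ext_iff.1 (h1.symm.trans h1') v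
      · exact Set.ext_iff.1 (h2.symm.trans h2') v
    rfl
  · rintro ⟨σ, S⟩ ⟨A, B, σ', σ''⟩ ⟨h1, h2, e', e'', k1, k2, k3, k4⟩
    refine h σ S A B σ' σ'' e' e'' h1 h2 k1 k2 k3 k4 ?_
    -- The cardinalities of the glued set, `V` and `W` split along `S`, `A`, `B` and their
    -- complements; subtracting gives additivity of the exponents.
    have c1 := σ.card_glue
    have c2 := σ'.card_glue
    have c3 := σ''.card_glue
    have c4 : Nat.card σ'.Glue = (S.1ᶜ).ncard := Nat.card_congr e'
    have c5 : Nat.card σ''.Glue = S.1.ncard := Nat.card_congr e''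
    have c6 := Set.ncard_add_ncard_compl S.1
    have c7 := Set.ncard_add_ncard_compl A.1
    have c8 := Set.ncard_add_ncard_compl B.1
    have d1 : Nat.card ↥A.1 = A.1.ncard := rfl
    have d2 : Nat.card ↥B.1 = B.1.ncard := rfl
    have d3 : Nat.card ↥(A.1ᶜ) = (A.1ᶜ).ncard := rfl
    have d4 : Nat.card ↥(B.1ᶜ) = (B.1ᶜ).ncard := rfl
    omega

end PartialInj

/-! ## Kinds of relations which can be glued -/

/-- A subset which is closed upwards for a relation. -/
abbrev IsUpper {V : Type} (r : V → V → Prop) (A : Set V) : Prop := ∀ i j : V, i ∈ A → r i j → j ∈ A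

/-- The union of the images of two relations. -/
def unionMap {V W T : Type} (f : V → T) (g : W → T) (r : V → V → Prop) (s : W → W → Prop)
    (x y : T) : Prop :=
  (∃ i j : V, r i j ∧ x = f i ∧ y = f j) ∨ (∃ i j : W, s i j ∧ x = g i ∧ y = g j)

/-- The hypotheses `hf` and `hg` ensure that every point of a piece landing in the range of `c`
comes from the smaller piece, so no related pair is lost. -/
theorem unionMap_comap {V W T V' W' T' : Type} {f : V → T} {g : W → T} {f' : V' → T'}
    {g' : W' → T'} {a : V' → V} {b : W' → W} {c : T' → T}
    (hc : Function.Injective c)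
    (hcf : ∀ v, c (f' v) = f (a v)) (hcg : ∀ w, c (g' w) = g (b w))
    (hf : ∀ v, f v ∈ Set.range c → v ∈ Set.range a)
    (hg : ∀ w, g w ∈ Set.range c → w ∈ Set.range b)
    {r : V → V → Prop} {s : W → W → Prop} {r' : V' → V' → Prop} {s' : W' → W' → Prop}
    (hr : ∀ i j, r' i j ↔ r (a i) (a j)) (hs : ∀ i j, s' i j ↔ s (b i) (b j)) (x y : T') :
    unionMap f' g' r' s' x y ↔ unionMap f g r s (c x) (c y) := by
  constructor
  · rintro (⟨i, j, hij, rfl, rfl⟩ | ⟨i, j, hij, rfl, rfl⟩)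
    · exact Or.inl ⟨a i, a j, (hr i j).1 hij, hcf i, hcf j⟩
    · exact Or.inr ⟨b i, b j, (hs i j).1 hij, hcg i, hcg j⟩
  · rintro (⟨i, j, hij, h1, h2⟩ | ⟨i, j, hij, h1, h2⟩)
    · obtain ⟨i, rfl⟩ := hf i ⟨x, h1⟩
      obtain ⟨j, rfl⟩ := hf j ⟨y, h2⟩
      rw [← hcf] at h1 h2
      exact Or.inl ⟨i, j, (hr i j).2 hij, hc h1, hc h2⟩
    · obtain ⟨i, rfl⟩ := hg i ⟨x, h1⟩
      obtain ⟨j, rfl⟩ := hg j ⟨y, h2⟩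
      rw [← hcg] at h1 h2
      exact Or.inr ⟨i, j, (hs i j).2 hij, hc h1, hc h2⟩

theorem isUpper_unionMap {V W T : Type} {f : V → T} {g : W → T}
    {r : V → V → Prop} {s : W → W → Prop} (A : Set T) :
    IsUpper (unionMap f g r s) A ↔ IsUpper r (f ⁻¹' A) ∧ IsUpper s (g ⁻¹' A) := by
  constructor
  · intro hA
    exact ⟨fun i j hi hij => hA _ _ hi (Or.inl ⟨i, j, hij, rfl, rfl⟩),
      fun i j hi hij => hA _ _ hi (Or.inr ⟨i, j, hij, rfl, rfl⟩)⟩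
  · rintro ⟨h1, h2⟩ x y hx (⟨i, j, hij, rfl, rfl⟩ | ⟨i, j, hij, rfl, rfl⟩)
    · exact h1 i j hx hij
    · exact h2 i j hx hij

/-- Being an ideal propagates along chains, so it depends only on a generating relation. This is why
the ideals of a glued quasi-poset are seen on the pieces. -/
theorem isUpper_transGen {T : Type} {r : T → T → Prop} {A : Set T} :
    IsUpper (Relation.TransGen r) A ↔ IsUpper r A := by
  constructor
  · exact fun h i j hi hij => h i j hi (.single hij)
  · intro h i j hi hij
    induction hij with
    | single hij => exact h _ _ hi hij
    | tail _ hjk ih => exact h _ _ ih hjk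

theorem isUpper_reflTransGen {T : Type} {r : T → T → Prop} {A : Set T} :
    IsUpper (Relation.ReflTransGen r) A ↔ IsUpper r A := by
  constructor
  · exact fun h i j hi hij => h i j hi (.single hij)
  · intro h i j hi hij
    induction hij with
    | refl => exact hi
    | tail _ hjk ih => exact h _ _ ih hjk

/-- The reflexive transitive closure commutes with restriction to a subset which is closed upwards
or downwards. -/
theorem reflTransGen_comap {T T' : Type} {R : T → T → Prop} {R' : T' → T' → Prop} {c : T' → T}
    (hc : Function.Injective c) (hR : ∀ x y, R' x y ↔ R (c x) (c y))
    (hu : IsUpper R (Set.range c) ∨ IsUpper R (Set.range c)ᶜ) (x y : T') :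
    Relation.ReflTransGen R' x y ↔ Relation.ReflTransGen R (c x) (c y) := by
  constructor
  · exact fun h => Relation.ReflTransGen.lift c (fun i j => (hR i j).1) _ _ h
  · intro h
    rcases hu with hu | hu
    -- When the range is closed upwards, a path followed forwards from `c x` never leaves it.
    · have key : ∀ z, Relation.ReflTransGen R (c x) z →
          ∃ z', c z' = z ∧ Relation.ReflTransGen R' x z' := by
        intro z hz
        induction hz with
        | refl => exact ⟨x, rfl, .refl⟩
        | tail _ hjk ih =>
          obtain ⟨z', rfl, hz'⟩ := ih
          obtain ⟨w, rfl⟩ := hu _ _ ⟨z', rfl⟩ hjk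
          exact ⟨w, rfl, hz'.tail ((hR _ _).2 hjk)⟩
      obtain ⟨z, hz, hz'⟩ := key _ h
      rwa [hc hz] at hz'
    -- When the complement is closed upwards, a path that leaves the range cannot return, so the
    -- path is followed backwards from `c y`.
    · have key : ∀ z, Relation.ReflTransGen R z (c y) →
          ∃ z', c z' = z ∧ Relation.ReflTransGen R' z' y := by
        intro z hz
        induction hz using Relation.ReflTransGen.head_induction_on with
        | refl => exact ⟨y, rfl, .refl⟩
        | @head a _ hjk _ ih =>
          obtain ⟨z', rfl, hz'⟩ := ih
          by_cases ha : a ∈ Set.range c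
          · obtain ⟨w, rfl⟩ := ha
            exact ⟨w, rfl, hz'.head ((hR _ _).2 hjk)⟩
          · exact absurd ⟨z', rfl⟩ (hu _ _ ha hjk)
      obtain ⟨z, hz, hz'⟩ := key _ h
      rwa [hc hz] at hz'

/-- Detaching the last edge (range closed upwards) or the first one (complement closed upwards)
leaves a possibly trivial path whose new endpoint is still in the range. -/
theorem transGen_comap {T T' : Type} {R : T → T → Prop} {R' : T' → T' → Prop} {c : T' → T}
    (hc : Function.Injective c) (hR : ∀ x y, R' x y ↔ R (c x) (c y))
    (hu : IsUpper R (Set.range c) ∨ IsUpper R (Set.range c)ᶜ) (x y : T') :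
    Relation.TransGen R' x y ↔ Relation.TransGen R (c x) (c y) := by
  constructor
  · exact fun h => Relation.TransGen.lift c (fun i j => (hR i j).1) _ _ h
  · intro h
    rcases hu with hu | hu
    · obtain ⟨z, hz, hzy⟩ := Relation.TransGen.tail'_iff.1 h
      have : z ∈ Set.range c := isUpper_reflTransGen.2 hu _ _ ⟨x, rfl⟩ hz
      obtain ⟨z, rfl⟩ := this
      exact Relation.TransGen.tail' ((reflTransGen_comap hc hR (Or.inl hu) x z).2 hz)
        ((hR _ _).2 hzy)
    · obtain ⟨z, hxz, hz⟩ := Relation.TransGen.head'_iff.1 h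
      by_cases hzc : z ∈ Set.range c
      · obtain ⟨z, rfl⟩ := hzc
        exact Relation.TransGen.head' ((hR _ _).2 hxz)
          ((reflTransGen_comap hc hR (Or.inr hu) z y).2 hz)
      · exact absurd ⟨y, rfl⟩ (isUpper_reflTransGen.2 hu _ _ hzc hz)

/-- A kind of relations, with a way of gluing two relations along a jointly surjective pair of
injections, compatible with restrictions: to all subsets if `Free` holds, and otherwise to those
which are closed upwards or downwards. -/
structure RelKind where
  Good : ∀ {V : Type}, (V → V → Prop) → Prop
  push : ∀ {V W T : Type}, (V → T) → (W → T) → (V → V → Prop) → (W → W → Prop) → T → T → Prop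
  Free : Prop
  good_push : ∀ {V W T : Type} {f : V → T} {g : W → T} (_ : IsJoint f g) {r : V → V → Prop}
    {s : W → W → Prop}, Good r → Good s → Good (push f g r s)
  good_comap : ∀ {V V' : Type} {a : V' → V} (_ : Function.Injective a) {r : V → V → Prop},
    Good r → Good (fun i j => r (a i) (a j))
  good_of_isEmpty : ∀ {V : Type} [IsEmpty V] (r : V → V → Prop), Good r
  -- For `c` bijective this is invariance under isomorphism; for `c` the inclusion of a subset it is
  -- compatibility with restriction, the only case in which the last hypothesis has content.
  push_comap : ∀ {V W T V' W' T' : Type} {f : V → T} {g : W → T} {f' : V' → T'}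
    {g' : W' → T'} (_ : IsJoint f g) (_ : IsJoint f' g') {a : V' → V} {b : W' → W} {c : T' → T}
    (_ : Function.Injective c)
    (_ : ∀ v, c (f' v) = f (a v)) (_ : ∀ w, c (g' w) = g (b w))
    (_ : ∀ v, f v ∈ Set.range c → v ∈ Set.range a)
    (_ : ∀ w, g w ∈ Set.range c → w ∈ Set.range b)
    {r : V → V → Prop} {s : W → W → Prop} {r' : V' → V' → Prop} {s' : W' → W' → Prop}
    (_ : ∀ i j, r' i j ↔ r (a i) (a j)) (_ : ∀ i j, s' i j ↔ s (b i) (b j))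
    (_ : Free ∨ IsUpper (push f g r s) (Set.range c) ∨ IsUpper (push f g r s) (Set.range c)ᶜ)
    (x y : T'), push f' g' r' s' x y ↔ push f g r s (c x) (c y)
  push_assoc : ∀ {U V W T₁ T₂ T : Type} {a : U → T₁} {b : V → T₁} {c : T₁ → T} {h : W → T}
    {a' : V → T₂} {b' : W → T₂} {f : U → T} {c' : T₂ → T}
    (_ : IsJoint a b) (_ : IsJoint c h) (_ : IsJoint a' b') (_ : IsJoint f c')
    (_ : ∀ u, c (a u) = f u) (_ : ∀ v, c (b v) = c' (a' v)) (_ : ∀ w, h w = c' (b' w))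
    (r : U → U → Prop) (s : V → V → Prop) (t : W → W → Prop) (x y : T),
    push c h (push a b r s) t x y ↔ push f c' r (push a' b' s t) x y
  push_empty_left : ∀ {V W T : Type} [IsEmpty V] {f : V → T} {g : W → T} (_ : IsJoint f g)
    {r : V → V → Prop} {s : W → W → Prop} (_ : Good s) (x y : W),
    push f g r s (g x) (g y) ↔ s x y
  push_empty_right : ∀ {V W T : Type} [IsEmpty W] {f : V → T} {g : W → T} (_ : IsJoint f g)
    {r : V → V → Prop} {s : W → W → Prop} (_ : Good r) (x y : V),
    push f g r s (f x) (f y) ↔ r x y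

/-- A kind of relations such that the upper sets of a gluing are those of the pieces. -/
structure IdealKind extends RelKind where
  isUpper_push : ∀ {V W T : Type} {f : V → T} {g : W → T} (_ : IsJoint f g)
    {r : V → V → Prop} {s : W → W → Prop} (A : Set T),
    IsUpper (push f g r s) A ↔ IsUpper r (f ⁻¹' A) ∧ IsUpper s (g ⁻¹' A)

/-- A kind of relations which can be restricted to all subsets. -/
structure FreeKind extends RelKind where
  isFree : Free

/-! ### Unions of relations and their transitive closures -/

theorem unionMap_assoc {U V W T₁ T₂ T : Type} {a : U → T₁} {b : V → T₁} {c : T₁ → T} {h : W → T}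
    {a' : V → T₂} {b' : W → T₂} {f : U → T} {c' : T₂ → T}
    (ha : ∀ u, c (a u) = f u) (hb : ∀ v, c (b v) = c' (a' v)) (hc : ∀ w, h w = c' (b' w))
    (r : U → U → Prop) (s : V → V → Prop) (t : W → W → Prop) :
    unionMap c h (unionMap a b r s) t = unionMap f c' r (unionMap a' b' s t) := by
  ext x y
  constructor
  · rintro (⟨i, j, (⟨i, j, hij, rfl, rfl⟩ | ⟨i, j, hij, rfl, rfl⟩), rfl, rfl⟩ |
      ⟨i, j, hij, rfl, rfl⟩)
    · exact Or.inl ⟨i, j, hij, ha i, ha j⟩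
    · exact Or.inr ⟨_, _, Or.inl ⟨i, j, hij, rfl, rfl⟩, hb i, hb j⟩
    · exact Or.inr ⟨_, _, Or.inr ⟨i, j, hij, rfl, rfl⟩, hc i, hc j⟩
  · rintro (⟨i, j, hij, rfl, rfl⟩ |
      ⟨i, j, (⟨i, j, hij, rfl, rfl⟩ | ⟨i, j, hij, rfl, rfl⟩), rfl, rfl⟩)
    · exact Or.inl ⟨_, _, Or.inl ⟨i, j, hij, rfl, rfl⟩, (ha i).symm, (ha j).symm⟩
    · exact Or.inl ⟨_, _, Or.inr ⟨i, j, hij, rfl, rfl⟩, (hb i).symm, (hb j).symm⟩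
    · exact Or.inr ⟨i, j, hij, (hc i).symm, (hc j).symm⟩

/-- A step of the inner closure is a chain of outer steps, so inner closures are absorbed. This
makes the bracketing of successive gluings irrelevant. -/
theorem transGen_unionMap_transGen_left {V W T : Type} {f : V → T} {g : W → T}
    {r : V → V → Prop} {s : W → W → Prop} :
    Relation.TransGen (unionMap f g (Relation.TransGen r) s) =
      Relation.TransGen (unionMap f g r s) := by
  ext x y
  constructor
  · intro h
    refine Relation.TransGen.trans_induction_on h ?_ fun _ _ => Relation.TransGen.trans
    rintro _ _ (⟨i, j, hij, rfl, rfl⟩ | ⟨i, j, hij, rfl, rfl⟩)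
    · exact Relation.TransGen.lift f (fun i j hij => Or.inl ⟨i, j, hij, rfl, rfl⟩) _ _ hij
    · exact .single (Or.inr ⟨i, j, hij, rfl, rfl⟩)
  · refine fun h => Relation.TransGen.mono ?_ _ _ h
    rintro _ _ (⟨i, j, hij, rfl, rfl⟩ | ⟨i, j, hij, rfl, rfl⟩)
    · exact Or.inl ⟨i, j, .single hij, rfl, rfl⟩
    · exact Or.inr ⟨i, j, hij, rfl, rfl⟩

theorem unionMap_swap {V W T : Type} (f : V → T) (g : W → T)
    (r : V → V → Prop) (s : W → W → Prop) : unionMap f g r s = unionMap g f s r := by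
  ext x y
  exact Or.comm

theorem transGen_unionMap_transGen_right {V W T : Type} {f : V → T} {g : W → T}
    {r : V → V → Prop} {s : W → W → Prop} :
    Relation.TransGen (unionMap f g r (Relation.TransGen s)) =
      Relation.TransGen (unionMap f g r s) := by
  rw [unionMap_swap, transGen_unionMap_transGen_left, unionMap_swap]

theorem transGen_eq_self {V : Type} {r : V → V → Prop} (h : ∀ i j k, r i j → r j k → r i k) :
    Relation.TransGen r = r := by
  ext x y
  exact ⟨fun hxy => Relation.TransGen.trans_induction_on hxy id fun _ _ => h _ _ _, .single⟩

theorem unionMap_empty_left {V W T : Type} [IsEmpty V] {f : V → T} {g : W → T} (h : IsJoint f g)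
    {r : V → V → Prop} {s : W → W → Prop} (x y : W) :
    unionMap f g r s (g x) (g y) ↔ s x y := by
  constructor
  · rintro (⟨i, _⟩ | ⟨i, j, hij, h1, h2⟩)
    · exact isEmptyElim i
    · rwa [h.inj_right h1, h.inj_right h2]
  · exact fun h => Or.inr ⟨x, y, h, rfl, rfl⟩

theorem IsJoint.swap {V W T : Type} {f : V → T} {g : W → T} (h : IsJoint f g) : IsJoint g f :=
  ⟨h.inj_right, h.inj_left, fun t => (h.surj t).symm⟩

theorem unionMap_empty_right {V W T : Type} [IsEmpty W] {f : V → T} {g : W → T} (h : IsJoint f g)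
    {r : V → V → Prop} {s : W → W → Prop} (x y : V) :
    unionMap f g r s (f x) (f y) ↔ r x y := by
  rw [unionMap_swap, unionMap_empty_left h.swap]

theorem IsJoint.isUpper_range_right {V W T : Type} [IsEmpty V] {f : V → T} {g : W → T}
    (h : IsJoint f g) (r : T → T → Prop) : IsUpper r (Set.range g) := fun _ j _ _ =>
  (h.surj j).elim (fun ⟨v, _⟩ => isEmptyElim v) id

/-! ### The kinds in use: graphs, quasi-orders, the trivial relation, total orders -/

/-- Simple graphs: irreflexive relations. Loops are deleted when gluing. -/
def graphKind : IdealKind where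
  Good r := ∀ i, ¬ r i i
  push f g r s x y := x ≠ y ∧ unionMap f g r s x y
  Free := True
  good_push _ _ _ _ _ _ h := h.1 rfl
  good_comap _ _ h i := h _
  good_of_isEmpty _ i := isEmptyElim i
  push_comap _ _ _ _ _ hc hcf hcg hf hg _ _ _ _ hr hs _ x y := by
    rw [unionMap_comap hc hcf hcg hf hg hr hs, hc.ne_iff]
  push_assoc _ hc _ hc' ha hb h r s t x y := by
    refine and_congr_right fun hxy => ?_
    have assoc := congrFun (congrFun (unionMap_assoc ha hb h r s t) x) y
    refine Iff.trans ?_ ((iff_of_eq assoc).trans ?_)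
    -- Deleting loops at the inner stage loses nothing: their images are loops, excluded by `x ≠ y`.
    · refine or_congr ?_ Iff.rfl
      constructor
      · rintro ⟨i, j, hij, rfl, rfl⟩
        exact ⟨i, j, hij.2, rfl, rfl⟩
      · rintro ⟨i, j, hij, rfl, rfl⟩
        exact ⟨i, j, ⟨fun h => hxy (h ▸ rfl), hij⟩, rfl, rfl⟩
    · refine or_congr Iff.rfl ?_
      constructor
      · rintro ⟨i, j, hij, rfl, rfl⟩
        exact ⟨i, j, ⟨fun h => hxy (h ▸ rfl), hij⟩, rfl, rfl⟩
      · rintro ⟨i, j, hij, rfl, rfl⟩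
        exact ⟨i, j, hij.2, rfl, rfl⟩
  push_empty_left h _ _ hs x y := by
    rw [unionMap_empty_left h, h.inj_right.ne_iff]
    exact ⟨And.right, fun hxy => ⟨fun e => hs x (by rwa [← e] at hxy), hxy⟩⟩
  push_empty_right h _ _ hs x y := by
    rw [unionMap_empty_right h, h.inj_left.ne_iff]
    exact ⟨And.right, fun hxy => ⟨fun e => hs x (by rwa [← e] at hxy), hxy⟩⟩
  isUpper_push _ r s A := by
    rw [← isUpper_unionMap]
    refine ⟨fun hA i j hi hij => ?_, fun hA i j hi hij => hA i j hi hij.2⟩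
    -- A deleted loop imposes no condition on upper sets.
    by_cases e : i = j
    · exact e ▸ hi
    · exact hA i j hi ⟨e, hij⟩

/-- Quasi-orders, glued by the transitive closure of the union. -/
def quasiOrderKind : IdealKind where
  Good r := (∀ i, r i i) ∧ ∀ i j k, r i j → r j k → r i k
  push f g r s := Relation.TransGen (unionMap f g r s)
  Free := False
  good_push h _ _ hr hs := by
    refine ⟨fun t => .single ?_, fun _ _ _ => Relation.TransGen.trans⟩
    rcases h.surj t with ⟨v, rfl⟩ | ⟨w, rfl⟩
    · exact Or.inl ⟨v, v, hr.1 v, rfl, rfl⟩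
    · exact Or.inr ⟨w, w, hs.1 w, rfl, rfl⟩
  good_comap _ _ h := ⟨fun _ => h.1 _, fun _ _ _ => h.2 _ _ _⟩
  good_of_isEmpty _ := ⟨fun i => isEmptyElim i, fun i => isEmptyElim i⟩
  push_comap _ _ _ _ _ hc hcf hcg hf hg _ _ _ _ hr hs hu x y := by
    rw [false_or, isUpper_transGen, isUpper_transGen] at hu
    exact transGen_comap hc (unionMap_comap hc hcf hcg hf hg hr hs) hu x y
  push_assoc _ _ _ _ ha hb h r s t x y := by
    rw [transGen_unionMap_transGen_left, transGen_unionMap_transGen_right,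
      unionMap_assoc ha hb h]
  push_empty_left h r s hs x y := by
    rw [← transGen_comap h.inj_right (fun x y => (unionMap_empty_left h x y).symm)
      (Or.inl (h.isUpper_range_right _)), transGen_eq_self hs.2]
  push_empty_right h r s hr x y := by
    rw [← transGen_comap h.inj_left (fun x y => (unionMap_empty_right h x y).symm)
      (Or.inl (h.swap.isUpper_range_right _)), transGen_eq_self hr.2]
  isUpper_push _ r s A := by rw [isUpper_transGen, isUpper_unionMap]

/-- The full relation, carrying no information. -/
def trivialKind : FreeKind where
  isFree := trivial
  Good r := ∀ i j, r i j
  push _ _ _ _ _ _ := True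
  Free := True
  good_push _ _ _ _ _ _ _ := trivial
  good_comap _ _ h _ _ := h _ _
  good_of_isEmpty _ i := isEmptyElim i
  push_comap _ _ _ _ _ _ _ _ _ _ _ _ _ _ _ _ _ _ _ := Iff.rfl
  push_assoc _ _ _ _ _ _ _ _ _ _ _ _ := Iff.rfl
  push_empty_left _ _ _ hs x y := ⟨fun _ => hs x y, fun _ => trivial⟩
  push_empty_right _ _ _ hs x y := ⟨fun _ => hs x y, fun _ => trivial⟩

/-- The gluing of two total orders: the elements coming from the first one, followed by
the elements coming only from the second one. -/
def orderPush {V W T : Type} (f : V → T) (g : W → T) (r : V → V → Prop) (s : W → W → Prop)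
    (x y : T) : Prop :=
  (∃ i j, r i j ∧ x = f i ∧ y = f j) ∨ (x ∈ Set.range f ∧ y ∉ Set.range f) ∨
    (x ∉ Set.range f ∧ y ∉ Set.range f ∧ ∃ i j, s i j ∧ x = g i ∧ y = g j)

section orderPush

variable {V W T : Type} {f : V → T} {g : W → T} {r : V → V → Prop} {s : W → W → Prop}

theorem orderPush_left_left (h : IsJoint f g) (i j : V) :
    orderPush f g r s (f i) (f j) ↔ r i j := by
  constructor
  · rintro (⟨i', j', hij, h1, h2⟩ | ⟨_, h2⟩ | ⟨h1, _⟩)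
    · rwa [h.inj_left h1, h.inj_left h2]
    · exact absurd ⟨j, rfl⟩ h2
    · exact absurd ⟨i, rfl⟩ h1
  · exact fun hij => Or.inl ⟨i, j, hij, rfl, rfl⟩

theorem orderPush_left (i : V) {y : T} (hy : y ∉ Set.range f) : orderPush f g r s (f i) y :=
  Or.inr (Or.inl ⟨⟨i, rfl⟩, hy⟩)

theorem not_orderPush_left (j : V) {x : T} (hx : x ∉ Set.range f) :
    ¬ orderPush f g r s x (f j) := by
  rintro (⟨i', j', hij, rfl, h2⟩ | ⟨_, h2⟩ | ⟨_, h2, _⟩)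
  · exact hx ⟨i', rfl⟩
  · exact h2 ⟨j, rfl⟩
  · exact h2 ⟨j, rfl⟩

theorem orderPush_right (h : IsJoint f g) {i j : W} (hi : g i ∉ Set.range f)
    (hj : g j ∉ Set.range f) : orderPush f g r s (g i) (g j) ↔ s i j := by
  constructor
  · rintro (⟨i', j', hij, h1, h2⟩ | ⟨h2, _⟩ | ⟨_, _, i', j', hij, h1, h2⟩)
    · exact absurd ⟨i', h1.symm⟩ hi
    · exact absurd h2 hi
    · rwa [h.inj_right h1, h.inj_right h2]
  · exact fun hij => Or.inr (Or.inr ⟨hi, hj, i, j, hij, rfl, rfl⟩)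

theorem IsJoint.cases (h : IsJoint f g) (t : T) :
    (∃ v, t = f v) ∨ ∃ w, t = g w ∧ g w ∉ Set.range f := by
  by_cases ht : t ∈ Set.range f
  · obtain ⟨v, rfl⟩ := ht
    exact Or.inl ⟨v, rfl⟩
  · rcases h.surj t with ⟨v, rfl⟩ | ⟨w, rfl⟩
    · exact absurd ⟨v, rfl⟩ ht
    · exact Or.inr ⟨w, rfl, ht⟩

end orderPush

/-- Total orders. -/
def orderKind : FreeKind where
  isFree := trivial
  Good r := (∀ i j, r i j ∨ r j i) ∧ (∀ i j, r i j → r j i → i = j) ∧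
    ∀ i j k, r i j → r j k → r i k
  push := orderPush
  Free := True
  good_push {V W T f g} h {r s} hr hs := by
    refine ⟨fun x y => ?_, fun x y hxy hyx => ?_, fun x y z hxy hyz => ?_⟩
    · rcases h.cases x with ⟨v, rfl⟩ | ⟨v, rfl, hv⟩ <;>
        rcases h.cases y with ⟨w, rfl⟩ | ⟨w, rfl, hw⟩
      · rw [orderPush_left_left h, orderPush_left_left h]; exact hr.1 _ _
      · exact Or.inl (orderPush_left _ hw)
      · exact Or.inr (orderPush_left _ hv)
      · rw [orderPush_right h hv hw, orderPush_right h hw hv]; exact hs.1 _ _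
    · rcases h.cases x with ⟨v, rfl⟩ | ⟨v, rfl, hv⟩ <;>
        rcases h.cases y with ⟨w, rfl⟩ | ⟨w, rfl, hw⟩
      · rw [orderPush_left_left h] at hxy hyx; rw [hr.2.1 _ _ hxy hyx]
      · exact absurd hyx (not_orderPush_left _ hw)
      · exact absurd hxy (not_orderPush_left _ hv)
      · rw [orderPush_right h hv hw] at hxy
        rw [orderPush_right h hw hv] at hyx
        rw [hs.2.1 _ _ hxy hyx]
    · rcases h.cases x with ⟨v, rfl⟩ | ⟨v, rfl, hv⟩ <;>
        rcases h.cases y with ⟨w, rfl⟩ | ⟨w, rfl, hw⟩ <;>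
        rcases h.cases z with ⟨u, rfl⟩ | ⟨u, rfl, hu⟩
      · rw [orderPush_left_left h] at hxy hyz ⊢; exact hr.2.2 _ _ _ hxy hyz
      · exact orderPush_left _ hu
      · exact absurd hyz (not_orderPush_left _ hw)
      · exact orderPush_left _ hu
      · exact absurd hxy (not_orderPush_left _ hv)
      · exact absurd hxy (not_orderPush_left _ hv)
      · exact absurd hyz (not_orderPush_left _ hw)
      · rw [orderPush_right h hv hw] at hxy
        rw [orderPush_right h hw hu] at hyz
        rw [orderPush_right h hv hu]
        exact hs.2.2 _ _ _ hxy hyz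
  good_comap ha _ h := ⟨fun _ _ => h.1 _ _, fun _ _ h1 h2 => ha (h.2.1 _ _ h1 h2),
    fun _ _ _ => h.2.2 _ _ _⟩
  good_of_isEmpty _ := ⟨fun i => isEmptyElim i, fun i => isEmptyElim i, fun i => isEmptyElim i⟩
  push_comap {V W T V' W' T' f g f' g'} h h' {a b c} hc hcf hcg hf hg {r s r' s'} hr hs _ x y := by
    -- A point coming only from `W'` must not come from `V`: by `hf`, such a preimage would lift to
    -- `V'`.
    have hn : ∀ w, g' w ∉ Set.range f' → g (b w) ∉ Set.range f := by
      rintro w hw ⟨v, hv⟩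
      obtain ⟨v, rfl⟩ := hf v ⟨g' w, by rw [hcg, hv]⟩
      exact hw ⟨v, hc (by rw [hcf, hcg, hv])⟩
    rcases h'.cases x with ⟨v, rfl⟩ | ⟨v, rfl, hv⟩ <;>
      rcases h'.cases y with ⟨w, rfl⟩ | ⟨w, rfl, hw⟩
    · rw [hcf, hcf, orderPush_left_left h, orderPush_left_left h', hr]
    · rw [hcf, hcg]
      exact iff_of_true (orderPush_left _ hw) (orderPush_left _ (hn _ hw))
    · rw [hcf, hcg]
      exact iff_of_false (not_orderPush_left _ hv) (not_orderPush_left _ (hn _ hv))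
    · rw [hcg, hcg, orderPush_right h (hn _ hv) (hn _ hw), orderPush_right h' hv hw, hs]
  push_assoc {U V W T₁ T₂ T a b c h a' b' f c'} hab hch hab' hfc ha hb hh r s t x y := by
    -- A point is ordered first by the earliest of `U`, `V`, `W` that it comes from, then inside it.
    -- The facts `n1`, `n2`, `n3` carry "not from an earlier factor" from the left bracketing to the
    -- right one.
    have n1 : ∀ v, b v ∉ Set.range a → c' (a' v) ∉ Set.range f := by
      rintro v hv ⟨u, hu⟩
      exact hv ⟨u, hch.inj_left (by rw [ha, hb, hu])⟩
    have n2 : ∀ w, h w ∉ Set.range c → c' (b' w) ∉ Set.range f := by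
      rintro w hw ⟨u, hu⟩
      exact hw ⟨a u, by rw [ha, hh, hu]⟩
    have n3 : ∀ w, h w ∉ Set.range c → b' w ∉ Set.range a' := by
      rintro w hw ⟨u, hu⟩
      exact hw ⟨b u, by rw [hb, hh, hu]⟩
    have key : ∀ x, (∃ u, x = c (a u)) ∨ (∃ v, x = c (b v) ∧ b v ∉ Set.range a) ∨
        ∃ w, x = h w ∧ h w ∉ Set.range c := by
      intro x
      rcases hch.cases x with ⟨x, rfl⟩ | ⟨w, rfl, hw⟩
      · rcases hab.cases x with ⟨u, rfl⟩ | ⟨v, rfl, hv⟩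
        · exact Or.inl ⟨u, rfl⟩
        · exact Or.inr (Or.inl ⟨v, rfl, hv⟩)
      · exact Or.inr (Or.inr ⟨w, rfl, hw⟩)
    rcases key x with ⟨u, rfl⟩ | ⟨v, rfl, hv⟩ | ⟨w, rfl, hw⟩ <;>
      rcases key y with ⟨u', rfl⟩ | ⟨v', rfl, hv'⟩ | ⟨w', rfl, hw'⟩
    · rw [orderPush_left_left hch, orderPush_left_left hab, ha, ha, orderPush_left_left hfc]
    · rw [orderPush_left_left hch, ha, hb]
      exact iff_of_true (orderPush_left _ hv') (orderPush_left _ (n1 _ hv'))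
    · refine iff_of_true (orderPush_left _ hw') ?_
      rw [ha, hh]
      exact orderPush_left _ (n2 _ hw')
    · rw [orderPush_left_left hch, ha, hb]
      exact iff_of_false (not_orderPush_left _ hv) (not_orderPush_left _ (n1 _ hv))
    · rw [orderPush_left_left hch, orderPush_right hab hv hv', hb, hb,
        orderPush_right hfc (n1 _ hv) (n1 _ hv'), orderPush_left_left hab']
    · refine iff_of_true (orderPush_left _ hw') ?_
      rw [hb, hh, orderPush_right hfc (n1 _ hv) (n2 _ hw')]
      exact orderPush_left _ (n3 _ hw')
    · refine iff_of_false (not_orderPush_left _ hw) ?_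
      rw [ha, hh]
      exact not_orderPush_left _ (n2 _ hw)
    · refine iff_of_false (not_orderPush_left _ hw) ?_
      rw [hb, hh, orderPush_right hfc (n2 _ hw) (n1 _ hv')]
      exact not_orderPush_left _ (n3 _ hw)
    · rw [orderPush_right hch hw hw', hh, hh, orderPush_right hfc (n2 _ hw) (n2 _ hw'),
        orderPush_right hab' (n3 _ hw) (n3 _ hw')]
  push_empty_left h r s hs x y := by
    refine orderPush_right h ?_ ?_ <;> rintro ⟨v, _⟩ <;> exact isEmptyElim v
  push_empty_right h r s hr x y := orderPush_left_left h x y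

noncomputable section

/-! ## Finite sets with two relations -/

/-- A finite set with a relation `r` of kind `k` and a relation `t` of kind `l`. -/
structure RelObj (k : IdealKind) (l : FreeKind) where
  V : Type
  finite : Finite V
  r : V → V → Prop
  t : V → V → Prop
  good_r : k.Good r
  good_t : l.Good t

attribute [instance] RelObj.finite

namespace RelObj

variable {k : IdealKind} {l : FreeKind}

/-- Isomorphisms: bijections preserving both relations. -/
def IsIso (P Q : RelObj k l) (e : P.V ≃ Q.V) : Prop :=
  (∀ i j, P.r i j ↔ Q.r (e i) (e j)) ∧ ∀ i j, P.t i j ↔ Q.t (e i) (e j)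

instance setoid (k : IdealKind) (l : FreeKind) : Setoid (RelObj k l) where
  r P Q := ∃ e, IsIso P Q e
  iseqv := by
    refine ⟨fun P => ⟨Equiv.refl _, fun _ _ => Iff.rfl, fun _ _ => Iff.rfl⟩, ?_, ?_⟩
    · rintro P Q ⟨e, h, h'⟩
      exact ⟨e.symm, fun i j => by simp [h], fun i j => by simp [h']⟩
    · rintro P Q R ⟨e, h, h'⟩ ⟨f, g, g'⟩
      exact ⟨e.trans f, fun i j => (h i j).trans (g _ _), fun i j => (h' i j).trans (g' _ _)⟩

/-- Isomorphism classes. -/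
def Class (k : IdealKind) (l : FreeKind) : Type 1 := Quotient (setoid k l)

/-- The isomorphism class of an object. -/
def cls (P : RelObj k l) : Class k l := Quotient.mk _ P

theorem cls_eq_iff {P Q : RelObj k l} : P.cls = Q.cls ↔ ∃ e, IsIso P Q e := Quotient.eq

theorem cls_eq {P Q : RelObj k l} (e : P.V ≃ Q.V) (he : IsIso P Q e) : P.cls = Q.cls :=
  cls_eq_iff.2 ⟨e, he⟩

/-- A representative of an isomorphism class. -/
def Class.out (c : Class k l) : RelObj k l := Quotient.out c

@[simp] theorem Class.cls_out (c : Class k l) : c.out.cls = c := Quotient.out_eq c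

theorem exists_isIso_out (P : RelObj k l) : ∃ e, IsIso P P.cls.out e :=
  cls_eq_iff.1 (P.cls.cls_out).symm

/-- The empty object. -/
def empty (k : IdealKind) (l : FreeKind) : RelObj k l where
  V := Empty
  finite := inferInstance
  r _ _ := True
  t _ _ := True
  good_r := k.good_of_isEmpty _
  good_t := l.good_of_isEmpty _

instance : IsEmpty (empty k l).V := inferInstanceAs (IsEmpty Empty)

/-- The gluing of two objects. -/
def glue (P Q : RelObj k l) (σ : PartialInj P.V Q.V) : RelObj k l where
  V := σ.Glue
  finite := inferInstance
  r := k.push σ.inl σ.inr P.r Q.r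
  t := l.push σ.inl σ.inr P.t Q.t
  good_r := k.good_push σ.isJoint P.good_r Q.good_r
  good_t := l.good_push σ.isJoint P.good_t Q.good_t

/-- The restriction of an object to a subset. -/
def restrict (P : RelObj k l) (A : Set P.V) : RelObj k l where
  V := A
  finite := inferInstance
  r i j := P.r i j
  t i j := P.t i j
  good_r := k.good_comap Subtype.val_injective P.good_r
  good_t := l.good_comap Subtype.val_injective P.good_t

theorem cls_eq_empty (P : RelObj k l) [IsEmpty P.V] : P.cls = (empty k l).cls :=
  cls_eq (Equiv.equivOfIsEmpty _ _) ⟨fun i => isEmptyElim i, fun i => isEmptyElim i⟩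

theorem cls_glue_congr {P Q P' Q' : RelObj k l} {a : P.V ≃ P'.V} {b : Q.V ≃ Q'.V}
    (ha : IsIso P P' a) (hb : IsIso Q Q' b) {σ : PartialInj P.V Q.V} {σ' : PartialInj P'.V Q'.V}
    (e : σ.Glue ≃ σ'.Glue) (h1 : ∀ v, e (σ.inl v) = σ'.inl (a v))
    (h2 : ∀ w, e (σ.inr w) = σ'.inr (b w)) : (P.glue Q σ).cls = (P'.glue Q' σ').cls := by
  -- The range of a bijection is everything, hence closed upwards for any relation.
  have hu : ∀ R, IsUpper R (Set.range e) := fun R i j _ _ => e.surjective j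
  refine cls_eq e ⟨?_, ?_⟩
  · exact k.push_comap σ'.isJoint σ.isJoint e.injective h1 h2 (fun v _ => a.surjective v)
      (fun w _ => b.surjective w) ha.1 hb.1 (Or.inr (Or.inl (hu _)))
  · exact l.push_comap σ'.isJoint σ.isJoint e.injective h1 h2 (fun v _ => a.surjective v)
      (fun w _ => b.surjective w) ha.2 hb.2 (Or.inl l.isFree)

theorem cls_glue_assoc {P Q R : RelObj k l} {σ : PartialInj P.V Q.V} {τ : PartialInj σ.Glue R.V}
    {σ' : PartialInj Q.V R.V} {τ' : PartialInj P.V σ'.Glue} (e : τ.Glue ≃ τ'.Glue)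
    (h1 : ∀ v, e (τ.inl (σ.inl v)) = τ'.inl v)
    (h2 : ∀ w, e (τ.inl (σ.inr w)) = τ'.inr (σ'.inl w))
    (h3 : ∀ x, e (τ.inr x) = τ'.inr (σ'.inr x)) :
    ((P.glue Q σ).glue R τ).cls = (P.glue (Q.glue R σ') τ').cls := by
  have hu : ∀ R, IsUpper R (Set.range e) := fun R i j _ _ => e.surjective j
  -- Transported along `e`, both bracketings live on the same set, where `push_assoc` compares them.
  have hj := τ.isJoint.equiv_comp e
  refine cls_eq e ⟨fun i j => ?_, fun i j => ?_⟩
  · refine Iff.trans ?_ (k.push_assoc σ.isJoint hj σ'.isJoint τ'.isJoint h1 h2 h3 _ _ _ _ _)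
    exact k.push_comap (a := id) (b := id) hj τ.isJoint e.injective (fun _ => rfl) (fun _ => rfl)
      (fun v _ => ⟨v, rfl⟩) (fun v _ => ⟨v, rfl⟩) (fun _ _ => Iff.rfl) (fun _ _ => Iff.rfl)
      (Or.inr (Or.inl (hu _))) i j
  · refine Iff.trans ?_ (l.push_assoc σ.isJoint hj σ'.isJoint τ'.isJoint h1 h2 h3 _ _ _ _ _)
    exact l.push_comap (a := id) (b := id) hj τ.isJoint e.injective (fun _ => rfl) (fun _ => rfl)
      (fun v _ => ⟨v, rfl⟩) (fun v _ => ⟨v, rfl⟩) (fun _ _ => Iff.rfl) (fun _ _ => Iff.rfl)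
      (Or.inl l.isFree) i j

theorem cls_glue_of_isEmpty_left {P Q : RelObj k l} [IsEmpty P.V] (σ : PartialInj P.V Q.V) :
    (P.glue Q σ).cls = Q.cls := by
  refine (cls_eq (Q := P.glue Q σ) (Equiv.ofBijective σ.inr ⟨σ.isJoint.inj_right, fun t =>
    (σ.isJoint.surj t).elim (fun ⟨v, _⟩ => isEmptyElim v) id⟩) ⟨fun i j => ?_, fun i j => ?_⟩).symm
  · exact (k.push_empty_left σ.isJoint Q.good_r i j).symm
  · exact (l.push_empty_left σ.isJoint Q.good_t i j).symm

theorem cls_glue_of_isEmpty_right {P Q : RelObj k l} [IsEmpty Q.V] (σ : PartialInj P.V Q.V) :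
    (P.glue Q σ).cls = P.cls := by
  refine (cls_eq (Q := P.glue Q σ) (Equiv.ofBijective σ.inl ⟨σ.isJoint.inj_left, fun t =>
    (σ.isJoint.surj t).elim id (fun ⟨v, _⟩ => isEmptyElim v)⟩) ⟨fun i j => ?_, fun i j => ?_⟩).symm
  · exact (k.push_empty_right σ.isJoint P.good_r i j).symm
  · exact (l.push_empty_right σ.isJoint P.good_t i j).symm

/-- The restriction to a subset of a gluing is the gluing of the restrictions. -/
theorem cls_glue_restrict {P Q : RelObj k l} {σ : PartialInj P.V Q.V} {S : Set σ.Glue}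
    (hS : IsUpper (P.glue Q σ).r S ∨ IsUpper (P.glue Q σ).r Sᶜ) {A : Set P.V} {B : Set Q.V}
    (hA : A = σ.inl ⁻¹' S) (hB : B = σ.inr ⁻¹' S) {σ' : PartialInj A B} (e : σ'.Glue ≃ S)
    (h1 : ∀ v, (e (σ'.inl v) : σ.Glue) = σ.inl v) (h2 : ∀ w, (e (σ'.inr w) : σ.Glue) = σ.inr w) :
    ((P.glue Q σ).restrict S).cls = ((P.restrict A).glue (Q.restrict B) σ').cls := by
  have hrange : Set.range (fun x => (e x : σ.Glue)) = S := by
    ext t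
    exact ⟨fun ⟨x, hx⟩ => hx ▸ (e x).2, fun ht => ⟨e.symm ⟨t, ht⟩, by simp⟩⟩
  have hc : Function.Injective (fun x => (e x : σ.Glue)) := Subtype.val_injective.comp e.injective
  refine (cls_eq (Q := (P.glue Q σ).restrict S) e ⟨?_, ?_⟩).symm
  · refine k.push_comap (a := Subtype.val) (b := Subtype.val) σ.isJoint σ'.isJoint hc h1 h2 ?_ ?_
      (fun _ _ => Iff.rfl) (fun _ _ => Iff.rfl) (Or.inr ?_)
    · intro v hv
      rw [hrange] at hv
      exact ⟨⟨v, hA ▸ hv⟩, rfl⟩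
    · intro v hv
      rw [hrange] at hv
      exact ⟨⟨v, hB ▸ hv⟩, rfl⟩
    · rw [hrange]
      exact hS
  · refine l.push_comap (a := Subtype.val) (b := Subtype.val) σ.isJoint σ'.isJoint hc h1 h2 ?_ ?_
      (fun _ _ => Iff.rfl) (fun _ _ => Iff.rfl) (Or.inl l.isFree)
    · intro v hv
      rw [hrange] at hv
      exact ⟨⟨v, hA ▸ hv⟩, rfl⟩
    · intro v hv
      rw [hrange] at hv
      exact ⟨⟨v, hB ▸ hv⟩, rfl⟩

theorem cls_restrict_congr {P Q : RelObj k l} {e : P.V ≃ Q.V} (he : IsIso P Q e) {A : Set P.V}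
    {B : Set Q.V} (h : ∀ v, v ∈ A ↔ e v ∈ B) : (P.restrict A).cls = (Q.restrict B).cls :=
  cls_eq (e.subtypeEquiv h) ⟨fun (i j : A) => he.1 i j, fun (i j : A) => he.2 i j⟩

theorem cls_restrict_of_eq_univ {P : RelObj k l} {A : Set P.V} (h : A = Set.univ) :
    (P.restrict A).cls = P.cls := by
  subst h
  exact cls_eq (Equiv.Set.univ _) ⟨fun _ _ => Iff.rfl, fun _ _ => Iff.rfl⟩

theorem cls_restrict_restrict {P : RelObj k l} {A B : Set P.V} {C : Set A}
    (h : ∀ v, v ∈ B ↔ ∃ hv : v ∈ A, ⟨v, hv⟩ ∈ C) :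
    ((P.restrict A).restrict C).cls = (P.restrict B).cls :=
  cls_eq (Q := P.restrict B) (Equiv.ofBijective (fun x : C => ⟨x.1.1, (h _).2 ⟨x.1.2, x.2⟩⟩)
    ⟨fun _ _ hxy => Subtype.ext (Subtype.ext (Subtype.mk.inj hxy)),
      fun ⟨v, hv⟩ => ⟨⟨⟨v, ((h v).1 hv).1⟩, ((h v).1 hv).2⟩, rfl⟩⟩)
    ⟨fun _ _ => Iff.rfl, fun _ _ => Iff.rfl⟩

/-! ## The vector space of isomorphism classes and its structure maps -/

variable {K : Type u} [Field K] (q : K)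

/-- The vector space with basis the isomorphism classes of objects, to be endowed with the product
of parameter `q`. -/
@[nolint unusedArguments]
def GlueHopf (k : IdealKind) (l : FreeKind) {K : Type u} [Field K] (_ : K) : Type (max 1 u) :=
  Class k l →₀ K

instance : AddCommGroup (GlueHopf k l q) := inferInstanceAs (AddCommGroup (Class k l →₀ K))

instance : Module K (GlueHopf k l q) := inferInstanceAs (Module K (Class k l →₀ K))

/-- The basis of isomorphism classes. -/
def basis (k : IdealKind) (l : FreeKind) : Module.Basis (Class k l) K (GlueHopf k l q) :=
  .ofRepr (LinearEquiv.refl K _)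

/-- The basis vector of an object. -/
def vec (P : RelObj k l) : GlueHopf k l q := basis q k l P.cls

variable {q} in
theorem vec_congr {P Q : RelObj k l} (h : P.cls = Q.cls) : vec q P = vec q Q := by rw [vec, vec, h]

-- Every class has a representative, so linear identities can be checked on vectors of objects,
-- where gluing and restriction are defined.
variable {q} in
theorem induction_vec {p : GlueHopf k l q → Prop} (zero : p 0) (add : ∀ x y, p x → p y → p (x + y))
    (smul : ∀ (a : K) x, p x → p (a • x)) (basis : ∀ P, p (vec q P)) (x : GlueHopf k l q) :
    p x := by
  have hx := (RelObj.basis q k l).mem_span x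
  refine Submodule.span_induction ?_ zero (fun x y _ _ => add x y) (fun a x _ => smul a x) hx
  rintro _ ⟨c, rfl⟩
  have := basis c.out
  rwa [vec, Class.cls_out] at this

variable {q} in
theorem linearMap_ext {M : Type*} [AddCommMonoid M] [Module K M] {f g : GlueHopf k l q →ₗ[K] M}
    (h : ∀ P, f (vec q P) = g (vec q P)) : f = g := by
  refine (basis q k l).ext fun c => ?_
  have := h c.out
  rwa [vec, Class.cls_out] at this

/-- The linear map determined by the values at chosen representatives. -/
def ofOut {M : Type*} [AddCommMonoid M] [Module K M] (F : RelObj k l → M) :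
    GlueHopf k l q →ₗ[K] M := (basis q k l).constr K fun c => F c.out

/-- Invariance of `F` under isomorphism makes the chosen representatives immaterial. -/
theorem ofOut_vec {M : Type*} [AddCommMonoid M] [Module K M] {F : RelObj k l → M}
    (hF : ∀ P Q e, IsIso P Q e → F P = F Q) (P : RelObj k l) : ofOut q F (vec q P) = F P := by
  rw [ofOut, vec, Module.Basis.constr_basis]
  obtain ⟨e, he⟩ := P.exists_isIso_out
  exact (hF _ _ e he).symm

/-! ### The algebra structure -/

/-- The product `P ·_q Q`. -/
def glueSum (P Q : RelObj k l) : GlueHopf k l q :=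
  ∑ σ : PartialInj P.V Q.V, q ^ σ.1.ncard • vec q (P.glue Q σ)

theorem glueSum_congr {P Q P' Q' : RelObj k l} {a : P.V ≃ P'.V} {b : Q.V ≃ Q'.V}
    (ha : IsIso P P' a) (hb : IsIso Q Q' b) : glueSum q P Q = glueSum q P' Q' :=
  PartialInj.sum_congr a b _ _ fun σ σ' e h1 h2 h3 => by
    rw [h3, vec_congr (cls_glue_congr ha hb e h1 h2)]

/-- The product as a bilinear map. -/
def mulLin : GlueHopf k l q →ₗ[K] GlueHopf k l q →ₗ[K] GlueHopf k l q :=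
  ofOut q fun P => ofOut q fun Q => glueSum q P Q

theorem isIso_refl (P : RelObj k l) : IsIso P P (Equiv.refl _) :=
  ⟨fun _ _ => Iff.rfl, fun _ _ => Iff.rfl⟩

theorem mulLin_vec (P Q : RelObj k l) : mulLin q (vec q P) (vec q Q) = glueSum q P Q := by
  rw [mulLin, ofOut_vec, ofOut_vec]
  · exact fun _ _ e he => glueSum_congr q (isIso_refl _) he
  · intro P P' e he
    refine linearMap_ext fun R => ?_
    rw [ofOut_vec, ofOut_vec]
    · exact glueSum_congr q he (isIso_refl _)
    · exact fun _ _ e he => glueSum_congr q (isIso_refl _) he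
    · exact fun _ _ e he => glueSum_congr q (isIso_refl _) he

instance : Mul (GlueHopf k l q) := ⟨fun x y => mulLin q x y⟩

instance : One (GlueHopf k l q) := ⟨vec q (empty k l)⟩

theorem mul_def (x y : GlueHopf k l q) : x * y = mulLin q x y := rfl

theorem one_def : (1 : GlueHopf k l q) = vec q (empty k l) := rfl

theorem vec_mul_vec (P Q : RelObj k l) :
    vec q P * vec q Q = ∑ σ : PartialInj P.V Q.V, q ^ σ.1.ncard • vec q (P.glue Q σ) :=
  mulLin_vec q P Q

protected theorem mul_assoc (x y z : GlueHopf k l q) : x * y * z = x * (y * z) := by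
  simp only [mul_def]
  induction x using induction_vec with
  | zero => simp
  | add x x' h h' => simp [h, h']
  | smul a x h => simp [h]
  | basis P =>
  induction y using induction_vec with
  | zero => simp
  | add x x' h h' => simp [h, h']
  | smul a x h => simp [h]
  | basis Q =>
  induction z using induction_vec with
  | zero => simp
  | add x x' h h' => simp [h, h']
  | smul a x h => simp [h]
  | basis R =>
  simp only [mulLin_vec, glueSum, map_sum, map_smul, LinearMap.sum_apply, LinearMap.smul_apply]
  simp only [Finset.smul_sum, smul_smul, ← pow_add]
  exact PartialInj.sum_assoc (fun σ τ => q ^ (σ.1.ncard + τ.1.ncard) • vec q ((P.glue Q σ).glue R τ))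
    (fun σ τ => q ^ (σ.1.ncard + τ.1.ncard) • vec q (P.glue (Q.glue R σ) τ))
    fun σ τ σ' τ' e h1 h2 h3 h4 => by rw [h4, vec_congr (cls_glue_assoc e h1 h2 h3)]

theorem _root_.PartialInj.eq_of_isEmpty_left {V W : Type} [IsEmpty V] (σ τ : PartialInj V W) :
    σ = τ := PartialInj.ext_of_inl_eq_inr fun v => isEmptyElim v

theorem _root_.PartialInj.eq_of_isEmpty_right {V W : Type} [IsEmpty W] (σ τ : PartialInj V W) :
    σ = τ := PartialInj.ext_of_inl_eq_inr fun _ w => isEmptyElim w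

/-- The partial injection with empty domain. -/
def _root_.PartialInj.bot (V W : Type) : PartialInj V W :=
  ⟨∅, fun x => x.2.elim, fun x => x.2.elim⟩

protected theorem one_mul (x : GlueHopf k l q) : 1 * x = x := by
  rw [mul_def, one_def]
  induction x using induction_vec with
  | zero => simp
  | add x x' h h' => simp [h, h']
  | smul a x h => simp [h]
  | basis P =>
  -- An empty factor leaves a single partial injection, with exponent zero.
  rw [mulLin_vec, glueSum, Fintype.sum_eq_single (PartialInj.bot _ _)
    fun σ hσ => absurd (PartialInj.eq_of_isEmpty_left σ _) hσ]
  simp [PartialInj.bot, vec_congr (cls_glue_of_isEmpty_left _)]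

protected theorem mul_one (x : GlueHopf k l q) : x * 1 = x := by
  rw [mul_def, one_def]
  induction x using induction_vec with
  | zero => simp
  | add x x' h h' => simp [h, h']
  | smul a x h => simp [h]
  | basis P =>
  rw [mulLin_vec, glueSum, Fintype.sum_eq_single (PartialInj.bot _ _)
    fun σ hσ => absurd (PartialInj.eq_of_isEmpty_right σ _) hσ]
  simp [PartialInj.bot, vec_congr (cls_glue_of_isEmpty_right _)]

instance : Ring (GlueHopf k l q) :=
  { (inferInstance : AddCommGroup (GlueHopf k l q)) with
    mul := (· * ·)
    one := 1
    mul_assoc := RelObj.mul_assoc q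
    one_mul := RelObj.one_mul q
    mul_one := RelObj.mul_one q
    left_distrib := fun x y z => by simp [mul_def]
    right_distrib := fun x y z => by simp [mul_def]
    zero_mul := fun x => by simp [mul_def]
    mul_zero := fun x => by simp [mul_def] }

instance : Algebra K (GlueHopf k l q) :=
  Algebra.ofModule (fun a x y => by simp [mul_def]) (fun a x y => by simp [mul_def])

/-! ### Coproduct, counit and compatibility with the product -/

/-- The coproduct of an object. -/
def cutSum (P : RelObj k l) : GlueHopf k l q ⊗[K] GlueHopf k l q :=
  ∑ A : RelIdeal P.r, vec q (P.restrict A.1ᶜ) ⊗ₜ[K] vec q (P.restrict A.1)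

theorem cutSum_congr {P Q : RelObj k l} {e : P.V ≃ Q.V} (he : IsIso P Q e) :
    cutSum q P = cutSum q Q := by
  refine Fintype.sum_eq_sum_of_biUnique (fun A B => ∀ v, v ∈ A.1 ↔ e v ∈ B.1) ?_ ?_ ?_ ?_ _ _ ?_
  · rintro ⟨A, hA⟩
    refine ⟨⟨e.symm ⁻¹' A, fun i j hi hij => hA _ _ hi ((he.1 _ _).2 ?_)⟩, fun v => ?_⟩
    · simpa using hij
    · simp
  · rintro ⟨A, hA⟩
    exact ⟨⟨e ⁻¹' A, fun i j hi hij => hA _ _ hi ((he.1 _ _).1 hij)⟩, fun v => Iff.rfl⟩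
  · intro A B B' h h'
    ext v
    obtain ⟨v, rfl⟩ := e.surjective v
    exact (h v).symm.trans (h' v)
  · intro A B B' h h'
    ext v
    exact (h v).trans (h' v).symm
  · intro A B h
    rw [vec_congr (cls_restrict_congr he h),
      vec_congr (cls_restrict_congr (A := A.1ᶜ) (B := B.1ᶜ) he fun v => not_congr (h v))]

open Classical in
/-- The counit at an object. -/
def emptyIndicator (K : Type u) [Field K] (P : RelObj k l) : K := if IsEmpty P.V then 1 else 0

theorem emptyIndicator_of_isEmpty (P : RelObj k l) [h : IsEmpty P.V] : emptyIndicator K P = 1 :=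
  if_pos h

theorem emptyIndicator_of_not_isEmpty {P : RelObj k l} (h : ¬ IsEmpty P.V) :
    emptyIndicator K P = 0 := if_neg h

instance : CoalgebraStruct K (GlueHopf k l q) where
  comul := ofOut q (cutSum q)
  counit := ofOut q (emptyIndicator K)

theorem comul_vec (P : RelObj k l) : Coalgebra.comul (R := K) (vec q P) =
    ∑ A : RelIdeal P.r, vec q (P.restrict A.1ᶜ) ⊗ₜ[K] vec q (P.restrict A.1) :=
  ofOut_vec q (fun _ _ _ he => cutSum_congr q he) P

theorem counit_vec (P : RelObj k l) :
    Coalgebra.counit (R := K) (vec q P) = emptyIndicator K P := by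
  refine ofOut_vec q (fun P Q e he => ?_) P
  by_cases h : IsEmpty P.V
  · have : IsEmpty Q.V := e.symm.isEmpty
    rw [emptyIndicator_of_isEmpty, emptyIndicator_of_isEmpty]
  · rw [emptyIndicator_of_not_isEmpty h, emptyIndicator_of_not_isEmpty]
    exact fun h' => h e.isEmpty

/-- Both sums run over chains of ideals `A ⊆ A'`: on the left `A' = A ∪ B` with `B` an ideal of the
complement of `A`, on the right `A` is an ideal of `A'`. The three tensor factors are the
restrictions to the complement of `A'`, to `A' \ A` and to `A`. -/
theorem coassoc_vec (P : RelObj k l) :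
    ∑ A : RelIdeal P.r, ∑ B : RelIdeal (P.restrict A.1ᶜ).r,
      vec q ((P.restrict A.1ᶜ).restrict B.1ᶜ) ⊗ₜ[K]
        (vec q ((P.restrict A.1ᶜ).restrict B.1) ⊗ₜ[K] vec q (P.restrict A.1)) =
    ∑ A : RelIdeal P.r, ∑ B : RelIdeal (P.restrict A.1).r,
      vec q (P.restrict A.1ᶜ) ⊗ₜ[K]
        (vec q ((P.restrict A.1).restrict B.1ᶜ) ⊗ₜ[K] vec q ((P.restrict A.1).restrict B.1)) := by
  classical
  have hl : ∀ F : (A : RelIdeal P.r) → RelIdeal (P.restrict A.1ᶜ).r →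
      GlueHopf k l q ⊗[K] (GlueHopf k l q ⊗[K] GlueHopf k l q), ∑ A, ∑ B, F A B =
      ∑ p : Σ A : RelIdeal P.r, RelIdeal (P.restrict A.1ᶜ).r, F p.1 p.2 := fun F => by
    rw [Fintype.sum_sigma]
  have hr : ∀ F : (A : RelIdeal P.r) → RelIdeal (P.restrict A.1).r →
      GlueHopf k l q ⊗[K] (GlueHopf k l q ⊗[K] GlueHopf k l q), ∑ A, ∑ B, F A B =
      ∑ p : Σ A : RelIdeal P.r, RelIdeal (P.restrict A.1).r, F p.1 p.2 := fun F => by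
    rw [Fintype.sum_sigma]
  rw [hl, hr]
  refine Fintype.sum_eq_sum_of_biUnique (fun (p : Σ A : RelIdeal P.r, RelIdeal (P.restrict A.1ᶜ).r)
    (p' : Σ A : RelIdeal P.r, RelIdeal (P.restrict A.1).r) =>
    (∀ v, v ∈ p'.1.1 ↔ v ∈ p.1.1 ∨ ∃ h, (⟨v, h⟩ : ↥(p.1.1ᶜ)) ∈ p.2.1) ∧
    ∀ v, v ∈ p.1.1 ↔ ∃ h, (⟨v, h⟩ : ↥(p'.1.1)) ∈ p'.2.1) ?_ ?_ ?_ ?_ _ _ ?_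
  · rintro ⟨⟨A, hA⟩, ⟨B, hB⟩⟩
    refine ⟨⟨⟨{v | v ∈ A ∨ ∃ h, (⟨v, h⟩ : ↥(Aᶜ)) ∈ B}, ?_⟩, ⟨{v | v.1 ∈ A}, ?_⟩⟩, ?_, ?_⟩
    · rintro i j (hi | ⟨hi, hi'⟩) hij
      · exact Or.inl (hA _ _ hi hij)
      · by_cases hj : j ∈ A
        · exact Or.inl hj
        · exact Or.inr ⟨hj, hB ⟨i, hi⟩ ⟨j, hj⟩ hi' hij⟩
    · exact fun i j hi hij => hA _ _ hi hij
    · exact fun v => Iff.rfl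
    · exact fun v => ⟨fun h => ⟨Or.inl h, h⟩, fun h => h.2⟩
  · rintro ⟨⟨A, hA⟩, ⟨B, hB⟩⟩
    refine ⟨⟨⟨{v | ∃ h, (⟨v, h⟩ : ↥A) ∈ B}, ?_⟩, ⟨{v | v.1 ∈ A}, ?_⟩⟩, ?_, ?_⟩
    · rintro i j ⟨hi, hi'⟩ hij
      exact ⟨hA _ _ hi hij, hB ⟨i, hi⟩ ⟨j, hA _ _ hi hij⟩ hi' hij⟩
    · exact fun i j hi hij => hA _ _ hi hij
    · intro v
      by_cases hv : v ∈ A <;> by_cases hv' : ∃ h, (⟨v, h⟩ : ↥A) ∈ B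
      · exact iff_of_true hv (Or.inl hv')
      · exact iff_of_true hv (Or.inr ⟨hv', hv⟩)
      · exact absurd hv'.1 hv
      · refine iff_of_false hv ?_
        rintro (h | ⟨_, h⟩)
        exacts [hv' h, hv h]
    · exact fun v => Iff.rfl
  · rintro ⟨⟨A, hA⟩, ⟨B, hB⟩⟩ ⟨⟨A', hA'⟩, ⟨B', hB'⟩⟩ ⟨⟨A'', hA''⟩, ⟨B'', hB''⟩⟩ ⟨h1, h2⟩ ⟨h3, h4⟩
    dsimp only at *
    obtain rfl : A' = A'' := Set.ext fun v => (h1 v).trans (h3 v).symm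
    obtain rfl : B' = B'' := by
      ext ⟨v, hv⟩
      have := (h2 v).symm.trans (h4 v)
      exact ⟨fun h => (this.1 ⟨hv, h⟩).2, fun h => (this.2 ⟨hv, h⟩).2⟩
    rfl
  · rintro ⟨⟨A', hA'⟩, ⟨B', hB'⟩⟩ ⟨⟨A'', hA''⟩, ⟨B'', hB''⟩⟩ ⟨⟨A, hA⟩, ⟨B, hB⟩⟩ ⟨h1, h2⟩ ⟨h3, h4⟩
    dsimp only at *
    obtain rfl : A' = A'' := Set.ext fun v => (h2 v).trans (h4 v).symm
    obtain rfl : B' = B'' := by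
      ext ⟨v, hv⟩
      have := (h1 v).symm.trans (h3 v)
      constructor
      · intro h
        exact ((this.1 (Or.inr ⟨hv, h⟩)).resolve_left hv).2
      · intro h
        exact ((this.2 (Or.inr ⟨hv, h⟩)).resolve_left hv).2
    rfl
  · rintro ⟨⟨A, hA⟩, ⟨B, hB⟩⟩ ⟨⟨A', hA'⟩, ⟨B', hB'⟩⟩ ⟨h1, h2⟩
    dsimp only at *
    have e1 : ((P.restrict Aᶜ).restrict Bᶜ).cls = (P.restrict A'ᶜ).cls := by
      refine cls_restrict_restrict fun v => ?_
      rw [Set.mem_compl_iff, h1, not_or]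
      exact ⟨fun h => ⟨h.1, fun h' => h.2 ⟨h.1, h'⟩⟩, fun ⟨h, h'⟩ => ⟨h, fun ⟨_, h''⟩ => h' h''⟩⟩
    have e2 : (P.restrict A).cls = ((P.restrict A').restrict B').cls :=
      (cls_restrict_restrict h2).symm
    have e3 : ((P.restrict Aᶜ).restrict B).cls = ((P.restrict A').restrict B'ᶜ).cls := by
      trans (P.restrict (A' \ A)).cls
      · refine cls_restrict_restrict fun v => ?_
        rw [Set.mem_sdiff, h1]
        exact ⟨fun h => h.1.resolve_left h.2, fun h => ⟨Or.inr h, h.1⟩⟩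
      · refine (cls_restrict_restrict fun v => ?_).symm
        rw [Set.mem_sdiff, h2]
        exact ⟨fun h => ⟨h.1, fun h' => h.2 ⟨_, h'⟩⟩, fun ⟨h, h'⟩ => ⟨h, fun ⟨_, h''⟩ => h' h''⟩⟩
    rw [vec_congr e1, vec_congr e2, vec_congr e3]

/-- The ideal with no element. -/
def _root_.RelIdeal.bot {V : Type} (r : V → V → Prop) : RelIdeal r := ⟨∅, fun _ _ h => h.elim⟩

/-- The ideal with all elements. -/
def _root_.RelIdeal.top {V : Type} (r : V → V → Prop) : RelIdeal r :=
  ⟨Set.univ, fun _ _ _ _ => trivial⟩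

theorem vec_restrict_top (P : RelObj k l) :
    vec q (P.restrict (RelIdeal.top P.r).1) = vec q P :=
  vec_congr (cls_restrict_of_eq_univ rfl)

theorem vec_restrict_bot_compl (P : RelObj k l) :
    vec q (P.restrict (RelIdeal.bot P.r).1ᶜ) = vec q P :=
  vec_congr (cls_restrict_of_eq_univ Set.compl_empty)

instance : Coalgebra K (GlueHopf k l q) where
  coassoc := by
    refine linearMap_ext fun P => ?_
    simp only [LinearMap.comp_apply, comul_vec, map_sum, LinearMap.rTensor_tmul,
      LinearMap.lTensor_tmul, TensorProduct.sum_tmul, TensorProduct.tmul_sum, LinearEquiv.coe_coe,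
      TensorProduct.assoc_tmul]
    exact coassoc_vec q P
  rTensor_counit_comp_comul := by
    refine linearMap_ext fun P => ?_
    simp only [LinearMap.comp_apply, comul_vec, map_sum, LinearMap.rTensor_tmul, counit_vec,
      TensorProduct.mk_apply]
    -- Only the full ideal has an empty complement, so the counit kills every other term.
    rw [Fintype.sum_eq_single (RelIdeal.top _)]
    · have : IsEmpty (P.restrict (RelIdeal.top P.r).1ᶜ).V := ⟨fun x => x.2 trivial⟩
      rw [emptyIndicator_of_isEmpty, vec_restrict_top]
    · intro A hA
      rw [emptyIndicator_of_not_isEmpty, TensorProduct.zero_tmul]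
      refine fun h => hA (Subtype.ext (Set.eq_univ_of_forall fun v => ?_))
      by_contra hv
      exact h.elim ⟨v, hv⟩
  lTensor_counit_comp_comul := by
    refine linearMap_ext fun P => ?_
    simp only [LinearMap.comp_apply, comul_vec, map_sum, LinearMap.lTensor_tmul, counit_vec,
      TensorProduct.mk_apply, LinearMap.flip_apply]
    rw [Fintype.sum_eq_single (RelIdeal.bot _)]
    · have : IsEmpty (P.restrict (RelIdeal.bot P.r).1).V := ⟨fun x => x.2⟩
      rw [emptyIndicator_of_isEmpty, vec_restrict_bot_compl]
    · intro A hA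
      rw [emptyIndicator_of_not_isEmpty, TensorProduct.tmul_zero]
      refine fun h => hA (Subtype.ext (Set.eq_empty_of_forall_notMem fun v hv => ?_))
      exact h.elim ⟨v, hv⟩

/-- After expansion, ideals of gluings are matched with gluings of ideals by
`PartialInj.sum_subset`, and restricting a gluing to an ideal or to its complement is gluing the
restrictions. -/
theorem comul_vec_mul_vec (P Q : RelObj k l) :
    Coalgebra.comul (R := K) (vec q P * vec q Q) =
      Coalgebra.comul (R := K) (vec q P) * Coalgebra.comul (R := K) (vec q Q) := by
  simp only [vec_mul_vec, map_sum, map_smul, comul_vec, Finset.sum_mul_sum, Finset.smul_sum,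
    Algebra.TensorProduct.tmul_mul_tmul, TensorProduct.sum_tmul, TensorProduct.tmul_sum,
    TensorProduct.smul_tmul_smul]
  -- The expansion produces the two inner sums in the opposite order.
  refine Eq.trans ?_ (Finset.sum_congr rfl fun A _ => Finset.sum_congr rfl fun B _ =>
    Finset.sum_comm)
  refine PartialInj.sum_subset (IsUpper P.r) (IsUpper Q.r)
    (fun σ => IsUpper (V := σ.Glue) (k.push σ.inl σ.inr P.r Q.r)) (fun σ S => k.isUpper_push σ.isJoint S)
    (fun σ S => q ^ σ.1.ncard • vec q ((P.glue Q σ).restrict S.1ᶜ) ⊗ₜ[K]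
      vec q ((P.glue Q σ).restrict S.1))
    (fun A B σ' σ'' => (q ^ σ'.1.ncard * q ^ σ''.1.ncard) •
      vec q ((P.restrict A.1ᶜ).glue (Q.restrict B.1ᶜ) σ') ⊗ₜ[K]
      vec q ((P.restrict A.1).glue (Q.restrict B.1) σ'')) ?_
  intro σ S A B σ' σ'' e' e'' hA hB h1 h2 h3 h4 h5
  have hS : IsUpper (P.glue Q σ).r (S.1ᶜᶜ : Set σ.Glue) := (compl_compl S.1).symm ▸ S.2
  have hAc : A.1ᶜ = σ.inl ⁻¹' S.1ᶜ := by rw [hA, Set.preimage_compl]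
  have hBc : B.1ᶜ = σ.inr ⁻¹' S.1ᶜ := by rw [hB, Set.preimage_compl]
  rw [h5, pow_add]
  exact congrArg₂ (fun x y => (q ^ σ'.1.ncard * q ^ σ''.1.ncard) • x ⊗ₜ[K] y)
    (vec_congr (cls_glue_restrict (Or.inr hS) hAc hBc e' h1 h2))
    (vec_congr (cls_glue_restrict (Or.inl S.2) hA hB e'' h3 h4))

/-- `P` embeds in every gluing, so no term is empty when `P` is nonempty; an empty `P` is the unit.
-/
theorem counit_vec_mul_vec (P Q : RelObj k l) :
    Coalgebra.counit (R := K) (vec q P * vec q Q) =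
      Coalgebra.counit (R := K) (vec q P) * Coalgebra.counit (R := K) (vec q Q) := by
  by_cases hP : IsEmpty P.V
  · have := hP
    rw [vec_congr P.cls_eq_empty, ← one_def, one_mul, one_def,
      counit_vec q (empty k l), emptyIndicator_of_isEmpty, one_mul]
  · rw [counit_vec q P, emptyIndicator_of_not_isEmpty hP, zero_mul, vec_mul_vec, map_sum]
    refine Finset.sum_eq_zero fun σ _ => ?_
    rw [map_smul, counit_vec, emptyIndicator_of_not_isEmpty, smul_zero]
    exact fun h => hP ⟨fun v => h.elim (σ.inl v)⟩

instance : Bialgebra K (GlueHopf k l q) :=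
  Bialgebra.mk' K (GlueHopf k l q)
    (by rw [one_def, counit_vec, emptyIndicator_of_isEmpty])
    (by
      intro x y
      induction x using induction_vec with
      | zero => simp
      | add x x' h h' => simp [add_mul, h, h']
      | smul a x h => simp [h, mul_assoc]
      | basis P =>
      induction y using induction_vec with
      | zero => simp
      | add x x' h h' => simp [mul_add, h, h']
      | smul a x h => simp [h, mul_left_comm]
      | basis Q => exact counit_vec_mul_vec q P Q)
    (by
      rw [one_def, comul_vec, Fintype.sum_eq_single (RelIdeal.bot _)]
      · rw [vec_restrict_bot_compl,
          vec_congr (cls_restrict_of_eq_univ (Set.eq_univ_of_forall fun v => isEmptyElim v))]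
        rfl
      · exact fun A hA => absurd (Subtype.ext (Set.ext fun v => isEmptyElim v)) hA)
    (by
      intro x y
      induction x using induction_vec with
      | zero => simp
      | add x x' h h' => simp [add_mul, h, h']
      | smul a x h => simp [h]
      | basis P =>
      induction y using induction_vec with
      | zero => simp
      | add x x' h h' => simp [mul_add, h, h']
      | smul a x h => simp [h]
      | basis Q => exact comul_vec_mul_vec q P Q)

end RelObj

end

noncomputable section

/-! ### Bialgebra morphisms and antipodes -/

/-- Morphisms of bialgebras between Hopf algebras commute with the antipodes. -/
theorem BialgHom.apply_antipode {R A B : Type*} [CommSemiring R] [Semiring A] [Semiring B]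
    [HopfAlgebra R A] [HopfAlgebra R B] (p : A →ₐc[R] B) (x : A) :
    p (HopfAlgebra.antipode R x) = HopfAlgebra.antipode R (p x) := by
  -- For convolution, `p` after the antipode is a left inverse of `p`, and the antipode after `p` is
  -- a right inverse; the two therefore coincide.
  open WithConv LinearMap in
  have h1 : toConv (p.toLinearMap ∘ₗ HopfAlgebra.antipode R) * toConv p.toLinearMap =
      (1 : WithConv (A →ₗ[R] B)) := by
    refine ofConv_injective ?_
    calc (toConv (p.toLinearMap ∘ₗ HopfAlgebra.antipode R) * toConv p.toLinearMap).ofConv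
        = (AlgHomClass.toAlgHom p).toLinearMap ∘ₗ
            (toConv (HopfAlgebra.antipode R) * toConv .id : WithConv (A →ₗ[R] A)).ofConv := by
          rw [algHom_comp_convMul_distrib]; rfl
      _ = (1 : WithConv (A →ₗ[R] B)).ofConv := by
          rw [LinearMap.antipode_mul_id, algHom_comp_convOne]
  have h2 : toConv p.toLinearMap * toConv (HopfAlgebra.antipode R ∘ₗ p.toLinearMap) =
      (1 : WithConv (A →ₗ[R] B)) := by
    refine ofConv_injective ?_
    calc (toConv p.toLinearMap * toConv (HopfAlgebra.antipode R ∘ₗ p.toLinearMap)).ofConv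
        = (toConv .id * toConv (HopfAlgebra.antipode R) : WithConv (B →ₗ[R] B)).ofConv ∘ₗ
            p.toCoalgHom.toLinearMap := by
          rw [convMul_comp_coalgHom_distrib]; rfl
      _ = (1 : WithConv (A →ₗ[R] B)).ofConv := by
          rw [LinearMap.id_mul_antipode, ← convOne_comp_coalgHom p.toCoalgHom]
  exact LinearMap.congr_fun (congrArg ofConv (left_inv_eq_right_inv h1 h2)) x

namespace RelObj

variable {k : IdealKind} {l : FreeKind} {K : Type u} [Field K] (q : K)

/-! ## The antipode -/

/-- The number of elements of the representatives of a class. -/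
def Class.size (c : Class k l) : ℕ := Nat.card c.out.V

theorem size_cls (P : RelObj k l) : P.cls.size = Nat.card P.V := by
  obtain ⟨e, _⟩ := P.exists_isIso_out
  exact (Nat.card_congr e).symm

theorem size_restrict_compl_lt (P : RelObj k l) {A : Set P.V} (hA : A.Nonempty) :
    (P.restrict Aᶜ).cls.size < Nat.card P.V := by
  rw [size_cls]
  have h1 := Set.ncard_add_ncard_compl A
  have h2 := (Set.ncard_pos A.toFinite).2 hA
  have h3 : Nat.card (P.restrict Aᶜ).V = Aᶜ.ncard := rfl
  omega

open Classical in
/-- The values on classes of a left inverse of `g` for the convolution product. -/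
def convLeftInv (g : GlueHopf k l q →ₗ[K] GlueHopf k l q) (c : Class k l) : GlueHopf k l q :=
  -- This solves the convolution equation for the term of the empty ideal, which is the unknown
  -- value itself when `g 1 = 1`; the other terms involve only smaller objects.
  algebraMap K _ (emptyIndicator K c.out) - ∑ A : RelIdeal c.out.r,
    if _ : A.1.Nonempty then
      convLeftInv g (c.out.restrict A.1ᶜ).cls * g (vec q (c.out.restrict A.1)) else 0
termination_by c.size
decreasing_by exact size_restrict_compl_lt _ ‹_›

-- The recursion removes a nonempty ideal at each stage. The value at `1` is recorded so that the
-- result can be applied again to the inverse obtained.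
open WithConv in
theorem exists_convLeftInv (g : GlueHopf k l q →ₗ[K] GlueHopf k l q) (hg : g 1 = 1) :
    ∃ g' : GlueHopf k l q →ₗ[K] GlueHopf k l q, g' 1 = 1 ∧ toConv g' * toConv g = 1 := by
  classical
  let g' : GlueHopf k l q →ₗ[K] GlueHopf k l q := (basis q k l).constr K (convLeftInv q g)
  have hg' : ∀ P, g' (vec q P) = convLeftInv q g P.cls := fun P =>
    (basis q k l).constr_basis K _ _
  have hmul : toConv g' * toConv g = 1 := by
    refine WithConv.ofConv_injective ((basis q k l).ext fun c => ?_)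
    have hc : basis q k l c = vec q c.out := by rw [vec, Class.cls_out]
    rw [hc]
    change LinearMap.mul' K _ (TensorProduct.map g' g (Coalgebra.comul (vec q c.out))) =
      algebraMap K _ (Coalgebra.counit (R := K) (vec q c.out))
    rw [comul_vec, counit_vec]
    simp only [map_sum, TensorProduct.map_tmul, LinearMap.mul'_apply]
    have split : ∀ A : RelIdeal c.out.r,
        g' (vec q (c.out.restrict A.1ᶜ)) * g (vec q (c.out.restrict A.1)) =
        (if A = RelIdeal.bot c.out.r then g' (vec q c.out) else 0) +
        if _ : A.1.Nonempty then
          convLeftInv q g (c.out.restrict A.1ᶜ).cls * g (vec q (c.out.restrict A.1)) else 0 := by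
      intro A
      by_cases hA : A.1.Nonempty
      · rw [dif_pos hA, if_neg, zero_add, hg']
        rintro rfl
        exact hA.some_mem
      · have hA' : A = RelIdeal.bot c.out.r := Subtype.ext (Set.not_nonempty_iff_eq_empty.1 hA)
        rw [dif_neg hA, if_pos hA', add_zero, hA', vec_restrict_bot_compl]
        have : IsEmpty (c.out.restrict (RelIdeal.bot c.out.r).1).V := ⟨fun x => x.2⟩
        rw [vec_congr (cls_eq_empty (c.out.restrict (RelIdeal.bot c.out.r).1)), ← one_def, hg, mul_one]
    rw [Finset.sum_congr rfl fun A _ => split A, Finset.sum_add_distrib,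
      Finset.sum_ite_eq' Finset.univ, if_pos (Finset.mem_univ _), hg', Class.cls_out]
    nth_rw 1 [convLeftInv]
    exact sub_add_cancel _ _
  refine ⟨g', ?_, hmul⟩
  -- Since `1` is grouplike, evaluating the convolution identity there gives `g' 1 * g 1 = 1`.
  have h := congrArg (fun f => f.ofConv 1) hmul
  change LinearMap.mul' K _ (TensorProduct.map g' g (Coalgebra.comul 1)) =
      algebraMap K _ (Coalgebra.counit (R := K) 1) at h
  rw [Bialgebra.comul_one, Algebra.TensorProduct.one_def, TensorProduct.map_tmul,
    LinearMap.mul'_apply, hg, mul_one, Bialgebra.counit_one] at h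
  rw [h, map_one]

-- A left inverse `S` of the identity has itself a left inverse `T`; associativity forces `T` to be
-- the identity, so `S` is two-sided.
open WithConv in
theorem exists_convInverse : ∃ S : GlueHopf k l q →ₗ[K] GlueHopf k l q,
    toConv S * toConv LinearMap.id = 1 ∧ toConv LinearMap.id * toConv S = 1 := by
  obtain ⟨S, hS, h⟩ := exists_convLeftInv q (LinearMap.id : GlueHopf k l q →ₗ[K] _) rfl
  obtain ⟨T, -, h'⟩ := exists_convLeftInv q S hS
  refine ⟨S, h, ?_⟩
  rwa [← left_inv_eq_right_inv h' h]

instance : HopfAlgebra K (GlueHopf k l q) :=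
  HopfAlgebra.ofConvInverse (exists_convInverse q).choose (exists_convInverse q).choose_spec.1
    (exists_convInverse q).choose_spec.2

/-! ## From graphs to quasi-posets -/

/-- The quasi-order of paths in a graph. -/
def closure (G : RelObj graphKind l) : RelObj quasiOrderKind l where
  V := G.V
  finite := G.finite
  r := Relation.ReflTransGen G.r
  t := G.t
  good_r := ⟨fun _ => .refl, fun _ _ _ => .trans⟩
  good_t := G.good_t

theorem closure_congr {G H : RelObj graphKind l} {e : G.V ≃ H.V} (he : IsIso G H e) :
    IsIso G.closure H.closure e :=
  ⟨reflTransGen_comap e.injective he.1 (Or.inl fun _ j _ _ => e.surjective j), he.2⟩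

/-- A path of `G` between two points of a set closed upwards or downwards stays in it; this may fail
for other subsets. -/
theorem closure_restrict (G : RelObj graphKind l) {A : Set G.V}
    (hA : IsUpper G.r A ∨ IsUpper G.r Aᶜ) :
    IsIso (G.closure.restrict A) (G.restrict A).closure (Equiv.refl _) := by
  refine ⟨fun i j => ?_, fun _ _ => Iff.rfl⟩
  exact (reflTransGen_comap (c := (Subtype.val : A → G.V)) Subtype.val_injective
    (fun _ _ => Iff.rfl) (by rwa [Subtype.range_coe]) i j).symm

/-- A step of the left side is a path in one piece, which maps to a path of the glued graph: the
loops deleted by gluing are absorbed as trivial paths. -/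
theorem closure_glue (G H : RelObj graphKind l) (σ : PartialInj G.V H.V) :
    IsIso (G.closure.glue H.closure σ) (G.glue H σ).closure (Equiv.refl _) := by
  refine ⟨fun x y => ?_, fun _ _ => Iff.rfl⟩
  change Relation.TransGen (unionMap σ.inl σ.inr _ _) x y ↔
    Relation.ReflTransGen (fun x y => x ≠ y ∧ unionMap σ.inl σ.inr G.r H.r x y) x y
  have step : ∀ x y, unionMap σ.inl σ.inr G.r H.r x y →
      Relation.ReflTransGen (fun x y => x ≠ y ∧ unionMap σ.inl σ.inr G.r H.r x y) x y := by
    intro x y h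
    by_cases hxy : x = y
    · exact hxy ▸ .refl
    · exact .single ⟨hxy, h⟩
  constructor
  · intro h
    refine Relation.TransGen.trans_induction_on h ?_ fun _ _ => Relation.ReflTransGen.trans
    rintro _ _ (⟨i, j, hij, rfl, rfl⟩ | ⟨i, j, hij, rfl, rfl⟩)
    · induction hij with
      | refl => exact .refl
      | tail _ h ih => exact ih.trans (step _ _ (Or.inl ⟨_, _, h, rfl, rfl⟩))
    · induction hij with
      | refl => exact .refl
      | tail _ h ih => exact ih.trans (step _ _ (Or.inr ⟨_, _, h, rfl, rfl⟩))
  · intro h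
    induction h with
    -- `Relation.TransGen` is not reflexive by itself; the trivial path uses reflexivity of the
    -- glued quasi-order.
    | refl => exact (G.closure.glue H.closure σ).good_r.1 x
    | tail _ h ih =>
      refine ih.tail ?_
      rcases h.2 with ⟨i, j, hij, rfl, rfl⟩ | ⟨i, j, hij, rfl, rfl⟩
      · exact Or.inl ⟨i, j, .single hij, rfl, rfl⟩
      · exact Or.inr ⟨i, j, .single hij, rfl, rfl⟩

/-- The linear map induced by `closure`. -/
def closureLin : GlueHopf graphKind l q →ₗ[K] GlueHopf quasiOrderKind l q :=
  ofOut q fun G => vec q G.closure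

theorem closureLin_vec (G : RelObj graphKind l) : closureLin q (vec q G) = vec q G.closure :=
  ofOut_vec q (fun _ _ _ he => vec_congr (cls_eq _ (closure_congr he))) G

theorem closureLin_one : closureLin q (1 : GlueHopf graphKind l q) = 1 := by
  rw [one_def, closureLin_vec]
  have : IsEmpty (empty graphKind l).closure.V := inferInstanceAs (IsEmpty Empty)
  exact vec_congr (cls_eq_empty _)

theorem closureLin_mul (x y : GlueHopf graphKind l q) :
    closureLin q (x * y) = closureLin q x * closureLin q y := by
  induction x using induction_vec with
  | zero => simp
  | add x x' h h' => simp [add_mul, h, h']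
  | smul a x h => simp [h]
  | basis P =>
  induction y using induction_vec with
  | zero => simp
  | add x x' h h' => simp [mul_add, h, h']
  | smul a x h => simp [h]
  | basis Q =>
  rw [vec_mul_vec, closureLin_vec, closureLin_vec, vec_mul_vec, map_sum]
  refine Finset.sum_congr rfl fun σ _ => ?_
  rw [map_smul, closureLin_vec]
  exact congrArg _ (vec_congr (cls_eq _ (closure_glue P Q σ)).symm)

/-- The morphism of bialgebras induced by `closure`. -/
def closureHom : GlueHopf graphKind l q →ₐc[K] GlueHopf quasiOrderKind l q :=
  .ofAlgHom (.ofLinearMap (closureLin q) (closureLin_one q) (closureLin_mul q))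
    (AlgHom.toLinearMap_injective <| linearMap_ext fun G => by
      change Coalgebra.counit (R := K) (closureLin q (vec q G)) = Coalgebra.counit (R := K) (vec q G)
      rw [closureLin_vec, counit_vec, counit_vec]
      rfl)
    (AlgHom.toLinearMap_injective <| linearMap_ext fun G => by
      change TensorProduct.map (closureLin q) (closureLin q) (Coalgebra.comul (R := K) (vec q G)) =
        Coalgebra.comul (R := K) (closureLin q (vec q G))
      rw [closureLin_vec, comul_vec, comul_vec, map_sum]
      simp only [TensorProduct.map_tmul, closureLin_vec]
      -- A graph and its path quasi-order have the same ideals.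
      refine Fintype.sum_equiv (Equiv.subtypeEquivRight fun A => isUpper_reflTransGen.symm) _ _
        fun A => ?_
      have hA : IsUpper G.r (A.1ᶜᶜ : Set G.V) := (compl_compl A.1).symm ▸ A.2
      exact congrArg₂ (fun x y => x ⊗ₜ[K] y)
        (vec_congr (cls_eq _ (closure_restrict G (Or.inr hA))).symm)
        (vec_congr (cls_eq _ (closure_restrict G (Or.inl A.2))).symm))

theorem closureHom_vec (G : RelObj graphKind l) : closureHom q (vec q G) = vec q G.closure :=
  closureLin_vec q G

end RelObj

end

noncomputable section

/-! ## The total order of a gluing -/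

namespace PartialInj

variable {V W : Type} [Finite V] [Finite W] [LinearOrder V] [LinearOrder W] (σ : PartialInj V W)

theorem minRep_le {x : σ.Glue} {a : V ⊕ₗ W} (h : σ.mk (ofLex a) = x) : σ.minRep x ≤ a :=
  Finset.min'_le (α := V ⊕ₗ W) _ _ ((Set.Finite.mem_toFinset _).2 h)

/-- Representatives in `W` come after all of `V`, and a class has at most one representative in `V`.
-/
theorem minRep_inl (v : V) : σ.minRep (σ.inl v) = toLex (Sum.inl v) := by
  have h := σ.mk_minRep (σ.inl v)
  have hle : σ.minRep (σ.inl v) ≤ toLex (Sum.inl v) := σ.minRep_le rfl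
  generalize σ.minRep (σ.inl v) = a at h hle
  induction a using Lex.rec with
  | h a =>
  rcases a with v' | w
  · rw [σ.isJoint.inj_left h]
  · exact absurd hle Sum.Lex.not_inr_le_inl

theorem minRep_inr {w : W} (hw : σ.inr w ∉ Set.range σ.inl) :
    σ.minRep (σ.inr w) = toLex (Sum.inr w) := by
  have h := σ.mk_minRep (σ.inr w)
  generalize σ.minRep (σ.inr w) = a at h
  induction a using Lex.rec with
  | h a =>
  rcases a with v | w'
  · exact absurd ⟨v, h⟩ hw
  · rw [σ.isJoint.inj_right h]

/-- A class meeting `V` is represented there and the others in `W`, so comparing least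
representatives is the gluing of total orders used in `orderKind`. -/
theorem glueOrder_le_iff (x y : σ.Glue) : σ.glueOrder.le x y ↔
    orderPush σ.inl σ.inr (fun i j => i ≤ j) (fun i j => i ≤ j) x y := by
  change σ.minRep x ≤ σ.minRep y ↔ _
  rcases σ.isJoint.cases x with ⟨v, rfl⟩ | ⟨v, rfl, hv⟩ <;>
    rcases σ.isJoint.cases y with ⟨w, rfl⟩ | ⟨w, rfl, hw⟩
  · rw [minRep_inl, minRep_inl, orderPush_left_left σ.isJoint, Sum.Lex.inl_le_inl_iff]
  · rw [minRep_inl, minRep_inr σ hw]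
    exact iff_of_true (Sum.Lex.inl_le_inr _ _) (orderPush_left _ hw)
  · rw [minRep_inl, minRep_inr σ hv]
    exact iff_of_false Sum.Lex.not_inr_le_inl (not_orderPush_left _ hv)
  · rw [minRep_inr σ hv, minRep_inr σ hw, orderPush_right σ.isJoint hv hw, Sum.Lex.inr_le_inr_iff]

end PartialInj

/-! ## Comparison with graphs and quasi-posets -/

namespace RelObj

variable {k : IdealKind} {l : FreeKind} {K : Type u} [Field K] (q : K)

/-- The bijection on classes induced by a map which is fully faithful on isomorphisms and
essentially surjective. -/
def classEquiv {X : Type 1} (s : Setoid X) (f : X → RelObj k l)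
    (h : ∀ x y, s x y ↔ (f x).cls = (f y).cls) (hs : ∀ P : RelObj k l, ∃ x, (f x).cls = P.cls) :
    Quotient s ≃ Class k l :=
  Equiv.ofBijective (Quotient.lift (fun x => (f x).cls) fun x y => (h x y).1) <| by
    constructor
    · rintro ⟨x⟩ ⟨y⟩ hxy
      exact Quotient.sound ((h x y).2 hxy)
    · intro c
      obtain ⟨x, hx⟩ := hs c.out
      exact ⟨Quotient.mk s x, hx.trans c.cls_out⟩

end RelObj

open RelObj

/-- A graph as a set with relations. -/
def SGraph.toRel (G : SGraph) : RelObj graphKind trivialKind where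
  V := G.V
  finite := G.finite
  r := G.Adj
  t _ _ := True
  good_r := G.loopless
  good_t _ _ := trivial

/-- A quasi-poset as a set with relations. -/
def QuasiPoset.toRel (P : QuasiPoset) : RelObj quasiOrderKind trivialKind where
  V := P.V
  finite := P.finite
  r := P.le
  t _ _ := True
  good_r := ⟨P.refl, P.trans⟩
  good_t _ _ := trivial

theorem orderKind_good_le {V : Type} (o : LinearOrder V) : orderKind.Good o.le :=
  ⟨o.le_total, o.le_antisymm, o.le_trans⟩

/-- The total order given by a relation. -/
abbrev orderKindOrder {V : Type} {t : V → V → Prop} (h : orderKind.Good t) : LinearOrder V where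
  le := t
  le_refl i := (h.1 i i).elim id id
  le_trans := h.2.2
  le_antisymm := h.2.1
  le_total := h.1
  toDecidableLE := Classical.decRel _

/-- An ordered graph as a set with relations. -/
def OrdSGraph.toRel (G : OrdSGraph) : RelObj graphKind orderKind where
  V := G.V
  finite := G.finite
  r := G.Adj
  t := G.ord.le
  good_r := G.loopless
  good_t := orderKind_good_le G.ord

/-- An ordered quasi-poset as a set with relations. -/
def OrdQuasiPoset.toRel (P : OrdQuasiPoset) : RelObj quasiOrderKind orderKind where
  V := P.V
  finite := P.finite
  r := P.le
  t := P.ord.le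
  good_r := ⟨P.refl, P.trans⟩
  good_t := orderKind_good_le P.ord

/-- Classes of graphs as classes of sets with relations. -/
def SGraph.classEquiv : SGraph.Class ≃ RelObj.Class graphKind trivialKind :=
  RelObj.classEquiv _ SGraph.toRel
    (fun _ _ => Iff.trans ⟨fun ⟨e⟩ => ⟨e.toEquiv, fun _ _ => e.map_rel_iff.symm, fun _ _ => Iff.rfl⟩,
      fun ⟨e, he⟩ => ⟨⟨e, (he.1 _ _).symm⟩⟩⟩ cls_eq_iff.symm)
    (fun P => ⟨⟨P.V, P.finite, P.r, P.good_r⟩, cls_eq (Equiv.refl _)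
      ⟨fun _ _ => Iff.rfl, fun i j => iff_of_true trivial (P.good_t i j)⟩⟩)

/-- Classes of quasi-posets as classes of sets with relations. -/
def QuasiPoset.classEquiv : QuasiPoset.Class ≃ RelObj.Class quasiOrderKind trivialKind :=
  RelObj.classEquiv _ QuasiPoset.toRel
    (fun _ _ => Iff.trans ⟨fun ⟨e⟩ => ⟨e.toEquiv, fun _ _ => e.map_rel_iff.symm, fun _ _ => Iff.rfl⟩,
      fun ⟨e, he⟩ => ⟨⟨e, (he.1 _ _).symm⟩⟩⟩ cls_eq_iff.symm)
    (fun P => ⟨⟨P.V, P.finite, P.r, P.good_r.1, P.good_r.2⟩, cls_eq (Equiv.refl _)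
      ⟨fun _ _ => Iff.rfl, fun i j => iff_of_true trivial (P.good_t i j)⟩⟩)

/-- Classes of ordered graphs as classes of sets with relations. -/
def OrdSGraph.classEquiv : OrdSGraph.Class ≃ RelObj.Class graphKind orderKind :=
  RelObj.classEquiv _ OrdSGraph.toRel
    (fun G H => (cls_eq_iff (P := G.toRel) (Q := H.toRel)).symm)
    (fun P => ⟨⟨⟨P.V, P.finite, P.r, P.good_r⟩, orderKindOrder P.good_t⟩, cls_eq (Equiv.refl _)
      ⟨fun _ _ => Iff.rfl, fun _ _ => Iff.rfl⟩⟩)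

/-- Classes of ordered quasi-posets as classes of sets with relations. -/
def OrdQuasiPoset.classEquiv : OrdQuasiPoset.Class ≃ RelObj.Class quasiOrderKind orderKind :=
  RelObj.classEquiv _ OrdQuasiPoset.toRel
    (fun P Q => (cls_eq_iff (P := P.toRel) (Q := Q.toRel)).symm)
    (fun P => ⟨⟨⟨P.V, P.finite, P.r, P.good_r.1, P.good_r.2⟩, orderKindOrder P.good_t⟩,
      cls_eq (Equiv.refl _) ⟨fun _ _ => Iff.rfl, fun _ _ => Iff.rfl⟩⟩)

/-- The edges agree by definition; only the total order, given by least representatives, has to be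
compared. -/
theorem OrdSGraph.cls_toRel_glue (G H : OrdSGraph) (σ : PartialInj G.V H.V) :
    (G.glue H σ).toRel.cls = (G.toRel.glue H.toRel σ).cls :=
  cls_eq (Equiv.refl _) ⟨fun _ _ => Iff.rfl, fun x y =>
    letI := G.ord; letI := H.ord; σ.glueOrder_le_iff x y⟩

theorem OrdQuasiPoset.cls_toRel_glue (P Q : OrdQuasiPoset) (σ : PartialInj P.V Q.V) :
    (P.glue Q σ).toRel.cls = (P.toRel.glue Q.toRel σ).cls :=
  cls_eq (Equiv.refl _) ⟨fun _ _ => Iff.rfl, fun x y =>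
    letI := P.ord; letI := Q.ord; σ.glueOrder_le_iff x y⟩

/-! ### Bases of isomorphism classes and their structure constants -/

section

variable {K : Type u} [Field K] (q : K)

/-- The basis of classes of graphs. -/
def SGraph.hopfBasis : Module.Basis SGraph.Class K (GlueHopf graphKind trivialKind q) :=
  (basis q _ _).reindex SGraph.classEquiv.symm

/-- The basis of classes of quasi-posets. -/
def QuasiPoset.hopfBasis :
    Module.Basis QuasiPoset.Class K (GlueHopf quasiOrderKind trivialKind q) :=
  (basis q _ _).reindex QuasiPoset.classEquiv.symm

/-- The basis of classes of ordered graphs. -/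
def OrdSGraph.hopfBasis : Module.Basis OrdSGraph.Class K (GlueHopf graphKind orderKind q) :=
  (basis q _ _).reindex OrdSGraph.classEquiv.symm

/-- The basis of classes of ordered quasi-posets. -/
def OrdQuasiPoset.hopfBasis :
    Module.Basis OrdQuasiPoset.Class K (GlueHopf quasiOrderKind orderKind q) :=
  (basis q _ _).reindex OrdQuasiPoset.classEquiv.symm

theorem SGraph.hopfBasis_cls (G : SGraph) : SGraph.hopfBasis q G.cls = vec q G.toRel := by
  rw [hopfBasis, Module.Basis.reindex_apply, Equiv.symm_symm]
  rfl

theorem QuasiPoset.hopfBasis_cls (P : QuasiPoset) :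
    QuasiPoset.hopfBasis q P.cls = vec q P.toRel := by
  rw [hopfBasis, Module.Basis.reindex_apply, Equiv.symm_symm]
  rfl

theorem OrdSGraph.hopfBasis_cls (G : OrdSGraph) : OrdSGraph.hopfBasis q G.cls = vec q G.toRel := by
  rw [hopfBasis, Module.Basis.reindex_apply, Equiv.symm_symm]
  rfl

theorem OrdQuasiPoset.hopfBasis_cls (P : OrdQuasiPoset) :
    OrdQuasiPoset.hopfBasis q P.cls = vec q P.toRel := by
  rw [hopfBasis, Module.Basis.reindex_apply, Equiv.symm_symm]
  rfl

theorem RelObj.counit_vec_of_nonempty {k : IdealKind} {l : FreeKind} (P : RelObj k l)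
    (h : Nonempty P.V) : Coalgebra.counit (R := K) (vec q P) = 0 := by
  rw [counit_vec, emptyIndicator_of_not_isEmpty (not_isEmpty_iff.2 h)]

theorem RelObj.counit_vec_of_isEmpty {k : IdealKind} {l : FreeKind} (P : RelObj k l)
    (h : IsEmpty P.V) : Coalgebra.counit (R := K) (vec q P) = 1 := by
  rw [counit_vec, emptyIndicator_of_isEmpty]

theorem RelObj.one_eq_vec {k : IdealKind} {l : FreeKind} (P : RelObj k l)
    (h : IsEmpty P.V) : 1 = vec q P := by
  rw [vec_congr P.cls_eq_empty, one_def]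

theorem SGraph.isHopfSG_hopfBasis : IsHopfSG q (SGraph.hopfBasis q) where
  one := by
    rw [hopfBasis_cls]
    exact one_eq_vec q _ (inferInstanceAs (IsEmpty Empty))
  mul P Q := by
    simp only [hopfBasis_cls]
    exact vec_mul_vec q P.toRel Q.toRel
  counit_empty := by
    rw [hopfBasis_cls]
    exact counit_vec_of_isEmpty q _ (inferInstanceAs (IsEmpty Empty))
  counit P h := by
    rw [hopfBasis_cls]
    exact counit_vec_of_nonempty q _ h
  comul P := by
    simp only [hopfBasis_cls]
    exact comul_vec q P.toRel

theorem QuasiPoset.isHopfQP_hopfBasis : IsHopfQP q (QuasiPoset.hopfBasis q) where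
  one := by
    rw [hopfBasis_cls]
    exact one_eq_vec q _ (inferInstanceAs (IsEmpty Empty))
  mul P Q := by
    simp only [hopfBasis_cls]
    exact vec_mul_vec q P.toRel Q.toRel
  counit_empty := by
    rw [hopfBasis_cls]
    exact counit_vec_of_isEmpty q _ (inferInstanceAs (IsEmpty Empty))
  counit P h := by
    rw [hopfBasis_cls]
    exact counit_vec_of_nonempty q _ h
  comul P := by
    simp only [hopfBasis_cls]
    exact comul_vec q P.toRel

theorem OrdSGraph.isHopfOrdSG_hopfBasis : IsHopfOrdSG q (OrdSGraph.hopfBasis q) where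
  one := by
    rw [hopfBasis_cls]
    exact one_eq_vec q _ (inferInstanceAs (IsEmpty Empty))
  mul P Q := by
    simp only [hopfBasis_cls, vec_congr (cls_toRel_glue P Q _)]
    exact vec_mul_vec q P.toRel Q.toRel
  counit_empty := by
    rw [hopfBasis_cls]
    exact counit_vec_of_isEmpty q _ (inferInstanceAs (IsEmpty Empty))
  counit P h := by
    rw [hopfBasis_cls]
    exact counit_vec_of_nonempty q _ h
  comul P := by
    simp only [hopfBasis_cls]
    exact comul_vec q P.toRel

theorem OrdQuasiPoset.isHopfOrdQP_hopfBasis : IsHopfOrdQP q (OrdQuasiPoset.hopfBasis q) where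
  one := by
    rw [hopfBasis_cls]
    exact one_eq_vec q _ (inferInstanceAs (IsEmpty Empty))
  mul P Q := by
    simp only [hopfBasis_cls, vec_congr (cls_toRel_glue P Q _)]
    exact vec_mul_vec q P.toRel Q.toRel
  counit_empty := by
    rw [hopfBasis_cls]
    exact counit_vec_of_isEmpty q _ (inferInstanceAs (IsEmpty Empty))
  counit P h := by
    rw [hopfBasis_cls]
    exact counit_vec_of_nonempty q _ h
  comul P := by
    simp only [hopfBasis_cls]
    exact comul_vec q P.toRel

end

end

/-! ### The theorem -/

theorem mainTheorem9 {K : Type u} [Field K] (q : K) :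
    -- quasi-posets
    (∃ (HSG HQP : Type (max 1 u)) (_ : Ring HSG) (_ : HopfAlgebra K HSG)
        (_ : Ring HQP) (_ : HopfAlgebra K HQP)
        (bSG : Module.Basis SGraph.Class K HSG) (bQP : Module.Basis QuasiPoset.Class K HQP),
      IsHopfSG q bSG ∧ IsHopfQP q bQP ∧
        ∃ p : HSG →ₐc[K] HQP,
          (∀ G : SGraph, p (bSG G.cls) = bQP G.toQP.cls) ∧
          ∀ x : HSG, p (HopfAlgebra.antipode K x) = HopfAlgebra.antipode K (p x)) ∧
    -- ordered quasi-posets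
    (∃ (HSG HQP : Type (max 1 u)) (_ : Ring HSG) (_ : HopfAlgebra K HSG)
        (_ : Ring HQP) (_ : HopfAlgebra K HQP)
        (bSG : Module.Basis OrdSGraph.Class K HSG)
        (bQP : Module.Basis OrdQuasiPoset.Class K HQP),
      IsHopfOrdSG q bSG ∧ IsHopfOrdQP q bQP ∧
        ∃ p : HSG →ₐc[K] HQP,
          (∀ G : OrdSGraph, p (bSG G.cls) = bQP G.toQP.cls) ∧
          ∀ x : HSG, p (HopfAlgebra.antipode K x) = HopfAlgebra.antipode K (p x)) := by
  refine ⟨⟨RelObj.GlueHopf graphKind trivialKind q, RelObj.GlueHopf quasiOrderKind trivialKind q,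
      inferInstance, inferInstance, inferInstance, inferInstance,
      SGraph.hopfBasis q, QuasiPoset.hopfBasis q, SGraph.isHopfSG_hopfBasis q,
      QuasiPoset.isHopfQP_hopfBasis q, RelObj.closureHom q, fun G => ?_,
      BialgHom.apply_antipode _⟩,
    ⟨RelObj.GlueHopf graphKind orderKind q, RelObj.GlueHopf quasiOrderKind orderKind q,
      inferInstance, inferInstance, inferInstance, inferInstance,
      OrdSGraph.hopfBasis q, OrdQuasiPoset.hopfBasis q, OrdSGraph.isHopfOrdSG_hopfBasis q,
      OrdQuasiPoset.isHopfOrdQP_hopfBasis q, RelObj.closureHom q, fun G => ?_,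
      BialgHom.apply_antipode _⟩⟩
  · rw [SGraph.hopfBasis_cls, QuasiPoset.hopfBasis_cls]
    -- The objects `G.toRel.closure` and `G.toQP.toRel` agree by definition.
    exact RelObj.closureHom_vec q G.toRel
  · rw [OrdSGraph.hopfBasis_cls, OrdQuasiPoset.hopfBasis_cls]
    exact RelObj.closureHom_vec q G.toRel
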